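/- Let $I$ be a countable set, and let $(A_v)_{v\in I}$ and $(A'_v)_{v\in I}$ be families of $C^*$-algebras with distinguished projections $p_v\in A_v$, $p'_v\in A'_v$ that are non-zero for all but finitely many $v$. The restricted tensor product $A=\bigotimes'_v(A_v,p_v)$ is the $C^*$-completion, in the spatial norm, of the span of the simple tensors $\otimes_v a_v$ with $a_v=p_v$ for all but finitely many $v$; $A'=\bigotimes'_v(A'_v,p'_v)$ is defined in the same way. For each $v$ let $X_v$ be a (right) Hilbert $C^*$-module over $A_v$ and $x_v\in X_v$ a vector, such that $\langle x_v,x_v\rangle=p_v$ for all but finitely many $v$, and let $\alpha_v:A'_v\to\mathrm{End}^*_{A_v}(X_v)$ be a $*$-homomorphism to the adjointable operators, such that $\alpha_v(p'_v)x_v=x_v$ for all but finitely many $v$. Let $X=\bigotimes'_v(X_v,x_v)$ be the restricted tensor product, that is, the Hilbert $A$-module obtained by completing the span of the simple tensors $\otimes_v w_v$ with $w_v=x_v$ for all but finitely many $v$, with $\langle\otimes_v w_v,\otimes_v z_v\rangle=\otimes_v\langle w_v,z_v\rangle$, and let $\alpha:A'\to\mathrm{End}^*_A(X)$ be the $*$-homomorphism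 with $\alpha(\otimes_v a'_v)(\otimes_v w_v)=\otimes_v\alpha_v(a'_v)w_v$. Assume that the collection of correspondences is type I: for all but finitely many $v$ the operator $\alpha_v(p'_v)$ is $z\mapsto x_v\langle x_v,z\rangle$ (the collection is coherent), and for every $v$ the image $\alpha_v(A'_v)$ contains the algebra $\mathbb K_{A_v}(X_v)$ of $A_v$-compact operators, the closed span of the operators $z\mapsto \xi\langle\eta,z\rangle$ with $\xi,\eta\in X_v$. Call a representation $(\pi,H)$ of a $C^*$-algebra $B$ type I if it is irreducible (there are no closed invariant subspaces other than $0$ and $H$; the zero space is allowed) and $\pi(B)$ contains all compact operators on $H$. Let $(\pi,H)$ be a factorizable representation of $A$: it is unitarily equivalent to a restricted tensor product $\bigotimes'_v\pi_v$ on $\bigotimes'_v(H_v,h_v)$, where the $\pi_v$ are representations of $A_v$ on Hilbert spaces $H_v$, and $h_v\in H_v$ is, for all but finitely many $v$, a unit vector with $\pi_v(p_v)h_v=h_v$. Then the induced representation $\alpha\otimes 1$ of $A'$ on $X\otimes_A H$ is unitarily equivalent to the restricted tensor product of the representations $\alpha_v\otimes 1$ of $A'_v$ on $\bigotimes'_v(X_v\otimes_{A_v}H_v,\,x_v\otimes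 h_v)$; and if $(\pi,H)$ is type I, then the representation $\alpha\otimes 1$ of $A'$ on $X\otimes_A H$ is type I as well. -/

import Mathlib

open Filter ComplexConjugate Topology
open scoped ENNReal ComplexOrder

noncomputable section

namespace AdelicTensor

/-! ### Hilbert spaces generated by positive semidefinite kernels -/

section Kernel

variable {S : Type*}

/-- The vector space freely spanned by `S`, to be equipped with the semi-inner product
`⟪s, t⟫ = K s t` of a positive semidefinite kernel `K`. -/
def PreKernelSpace (K : Matrix S S ℂ) (_hK : K.PosSemidef) : Type _ := S →₀ ℂ

variable (K : Matrix S S ℂ) (hK : K.PosSemidef)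

instance : AddCommGroup (PreKernelSpace K hK) := inferInstanceAs (AddCommGroup (S →₀ ℂ))
instance : Module ℂ (PreKernelSpace K hK) := inferInstanceAs (Module ℂ (S →₀ ℂ))

/-- The sesquilinear extension of the kernel to the free vector space. -/
def kernelForm (K : Matrix S S ℂ) (f g : S →₀ ℂ) : ℂ :=
  f.sum fun s z => g.sum fun t w => conj z * w * K s t

lemma conj_kernelForm (K : Matrix S S ℂ) (hK : K.IsHermitian) (f g : S →₀ ℂ) :
    conj (kernelForm K g f) = kernelForm K f g := by
  simp only [kernelForm, Finsupp.sum, map_sum]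
  rw [Finset.sum_comm]
  refine Finset.sum_congr rfl fun s _ => Finset.sum_congr rfl fun t _ => ?_
  rw [← hK.apply]
  simp [mul_comm]

lemma posSemidef_iff_kernelForm (K : Matrix S S ℂ) :
    K.PosSemidef ↔ K.IsHermitian ∧ ∀ f, 0 ≤ kernelForm K f f := by
  refine and_congr_right fun _ => forall_congr' fun f => ?_
  simp only [kernelForm, RCLike.star_def]
  simp only [mul_right_comm]

lemma kernelForm_gram {E : Type*} [SeminormedAddCommGroup E] [InnerProductSpace ℂ E]
    (F : S → E) (f g : S →₀ ℂ) : kernelForm (Matrix.gram ℂ F) f g =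
      inner ℂ (Finsupp.linearCombination ℂ F f) (Finsupp.linearCombination ℂ F g) := by
  simp only [kernelForm, Finsupp.linearCombination_apply, Finsupp.sum, Matrix.gram_apply]
  rw [sum_inner]
  refine Finset.sum_congr rfl fun s _ => ?_
  rw [inner_sum]
  refine Finset.sum_congr rfl fun t _ => ?_
  rw [inner_smul_left, inner_smul_right, mul_assoc]

lemma posSemidef_gram {E : Type*} [SeminormedAddCommGroup E] [InnerProductSpace ℂ E]
    (F : S → E) : (Matrix.gram ℂ F).PosSemidef := by
  refine (posSemidef_iff_kernelForm _).2 ⟨Matrix.isHermitian_gram ℂ F, fun f => ?_⟩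
  rw [kernelForm_gram, inner_self_eq_norm_sq_to_K]
  simp only [Complex.coe_algebraMap]
  have h : (0 : ℝ) ≤ ‖Finsupp.linearCombination ℂ F f‖ ^ 2 := sq_nonneg _
  exact_mod_cast h

instance preKernelCore : PreInnerProductSpace.Core ℂ (PreKernelSpace K hK) where
  inner := kernelForm K
  conj_inner_symm f g := conj_kernelForm K hK.1 f g
  add_left f g h := by
    refine (Finsupp.sum_add_index' (fun s => by simp [Finsupp.sum]) (fun s a b => ?_))
    simp [← Finset.sum_add_distrib, add_mul, Finsupp.sum]
  smul_left f g c := by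
    refine (Finsupp.sum_smul_index (fun s => by simp [Finsupp.sum])).trans ?_
    simp only [Finsupp.sum, Finset.mul_sum, map_mul, mul_assoc, kernelForm]
  re_inner_nonneg f := by
    have h := ((posSemidef_iff_kernelForm K).1 hK).2 f
    rw [Complex.nonneg_iff] at h
    exact h.1

instance : SeminormedAddCommGroup (PreKernelSpace K hK) :=
  InnerProductSpace.Core.toSeminormedAddCommGroup (𝕜 := ℂ)

instance : InnerProductSpace ℂ (PreKernelSpace K hK) := .ofCore _

/-- The Hilbert space generated by a positive semidefinite kernel `K` on `S`: the Hausdorff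
completion of the span of `S` for the semi-inner product `⟪s, t⟫ = K s t`. -/
def KernelSpace : Type _ := UniformSpace.Completion (PreKernelSpace K hK)

instance : NormedAddCommGroup (KernelSpace K hK) :=
  inferInstanceAs (NormedAddCommGroup (UniformSpace.Completion (PreKernelSpace K hK)))
instance : InnerProductSpace ℂ (KernelSpace K hK) :=
  inferInstanceAs (InnerProductSpace ℂ (UniformSpace.Completion (PreKernelSpace K hK)))
instance : CompleteSpace (KernelSpace K hK) :=
  inferInstanceAs (CompleteSpace (UniformSpace.Completion (PreKernelSpace K hK)))

/-- The linear map from the free vector space on `S` to the generated Hilbert space. -/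
def kernelLin : (S →₀ ℂ) →ₗ[ℂ] KernelSpace K hK :=
  (UniformSpace.Completion.toComplL (𝕜 := ℂ) (E := PreKernelSpace K hK)).toLinearMap

/-- The vector of the generated Hilbert space attached to a point of `S`. -/
def kernelVec (s : S) : KernelSpace K hK := kernelLin K hK (Finsupp.single s 1)

lemma inner_kernelLin (f g : S →₀ ℂ) : inner ℂ (kernelLin K hK f) (kernelLin K hK g) =
    kernelForm K f g :=
  UniformSpace.Completion.inner_coe (E := PreKernelSpace K hK) f g

@[simp] lemma inner_kernelVec (s t : S) :
    inner ℂ (kernelVec K hK s) (kernelVec K hK t) = K s t := by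
  simp [kernelVec, inner_kernelLin, kernelForm]

lemma denseRange_kernelLin : DenseRange (kernelLin K hK) :=
  UniformSpace.Completion.denseRange_coe (α := PreKernelSpace K hK)

lemma kernelLin_eq (f : S →₀ ℂ) :
    kernelLin K hK f = Finsupp.linearCombination ℂ (kernelVec K hK) f := by
  have : kernelLin K hK = Finsupp.linearCombination ℂ (kernelVec K hK) := by
    ext s; simp [kernelVec]
  rw [this]

variable {K hK}

/-- Two bounded operators which agree on the generating vectors are equal. -/
lemma kernel_ext {E : Type*} [NormedAddCommGroup E] [NormedSpace ℂ E]
    {T T' : KernelSpace K hK →L[ℂ] E} (h : ∀ s, T (kernelVec K hK s) = T' (kernelVec K hK s)) :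
    T = T' := by
  have h1 : T.toLinearMap ∘ₗ kernelLin K hK = T'.toLinearMap ∘ₗ kernelLin K hK := by
    ext s; simpa [kernelVec] using h s
  refine ContinuousLinearMap.coeFn_injective
    ((denseRange_kernelLin K hK).equalizer T.continuous T'.continuous ?_)
  funext f
  exact congr($h1 f)

/-- Vectors with the same inner products with the generating vectors are equal. -/
lemma kernelVec_ext {u v : KernelSpace K hK}
    (h : ∀ s, inner ℂ (kernelVec K hK s) u = inner ℂ (kernelVec K hK s) v) : u = v := by
  have h2 : innerSL ℂ u = innerSL ℂ v := kernel_ext fun s => by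
    simp only [innerSL_apply_apply]
    rw [← inner_conj_symm, h, inner_conj_symm]
  refine ext_inner_right ℂ fun w => ?_
  exact congr($h2 w)

/-- Adjointness can be checked on generating vectors. -/
lemma kernel_inner_ext {S' : Type*} {K' : Matrix S' S' ℂ} {hK' : K'.PosSemidef}
    {T : KernelSpace K hK →L[ℂ] KernelSpace K' hK'}
    {T' : KernelSpace K' hK' →L[ℂ] KernelSpace K hK}
    (h : ∀ s t, inner ℂ (T (kernelVec K hK s)) (kernelVec K' hK' t)
      = inner ℂ (kernelVec K hK s) (T' (kernelVec K' hK' t))) :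
    ContinuousLinearMap.adjoint T' = T := by
  symm
  refine kernel_ext fun s => kernelVec_ext fun t => ?_
  rw [ContinuousLinearMap.adjoint_inner_right, ← inner_conj_symm, h, inner_conj_symm]

variable (K hK) in
/-- The bounded operator sending the generating vector of `s` to `F s` (meaningful when `F`
satisfies a norm bound, and zero otherwise). -/
def kernelLift {E : Type*} [NormedAddCommGroup E] [NormedSpace ℂ E] [CompleteSpace E]
    (F : S → E) : KernelSpace K hK →L[ℂ] E :=
  (Finsupp.linearCombination ℂ F).extendOfNorm (kernelLin K hK)

lemma kernelLift_apply {E : Type*} [NormedAddCommGroup E] [NormedSpace ℂ E] [CompleteSpace E]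
    {F : S → E} {C : ℝ}
    (h : ∀ f : S →₀ ℂ, ‖Finsupp.linearCombination ℂ F f‖ ≤ C * ‖kernelLin K hK f‖) (s : S) :
    kernelLift K hK F (kernelVec K hK s) = F s := by
  simp [kernelLift, kernelVec, LinearMap.extendOfNorm_eq (denseRange_kernelLin K hK) ⟨C, h⟩]

lemma kernelLift_norm_le {E : Type*} [NormedAddCommGroup E] [NormedSpace ℂ E] [CompleteSpace E]
    {F : S → E} {C : ℝ} (hC : 0 ≤ C)
    (h : ∀ f : S →₀ ℂ, ‖Finsupp.linearCombination ℂ F f‖ ≤ C * ‖kernelLin K hK f‖) :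
    ‖kernelLift K hK F‖ ≤ C :=
  LinearMap.opNorm_extendOfNorm_le (denseRange_kernelLin K hK) hC h

end Kernel


/-! ### Restricted tensor products of Hilbert spaces -/

section Restricted

variable {I : Type*}

/-- The families `w = (w_v)` with `w_v = x_v` for all but finitely many `v`; they index the simple
tensors of a restricted tensor product with distinguished vectors `x`. -/
def RestrictedFamily (W : I → Type*) (x : ∀ v, W v) : Type _ :=
  {w : ∀ v, W v // ∀ᶠ v in cofinite, w v = x v}

instance (W : I → Type*) (x : ∀ v, W v) : CoeFun (RestrictedFamily W x) (fun _ => ∀ v, W v) :=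
  ⟨Subtype.val⟩

/-- Applying maps `T_v` with `T_v x_v = x'_v` for all but finitely many `v` componentwise. -/
def RestrictedFamily.map {W W' : I → Type*} {x : ∀ v, W v} {x' : ∀ v, W' v} (T : ∀ v, W v → W' v)
    (hT : ∀ᶠ v in cofinite, T v (x v) = x' v) (w : RestrictedFamily W x) :
    RestrictedFamily W' x' :=
  ⟨fun v => T v (w v), by filter_upwards [hT, w.2] with v h1 h2; rw [h2, h1]⟩

/-- The constant-at-the-distinguished-vectors family. -/
def RestrictedFamily.base {W : I → Type*} (x : ∀ v, W v) : RestrictedFamily W x :=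
  ⟨x, .of_forall fun _ => rfl⟩

section Hadamard

variable {S : Type*}

lemma posSemidef_prod (F : Finset I) {M : I → Matrix S S ℂ} (h : ∀ v, (M v).PosSemidef) :
    (Matrix.of fun s t => ∏ v ∈ F, M v s t).PosSemidef := by
  classical
  induction F using Finset.induction_on with
  | empty =>
    have : (Matrix.of fun s t => ∏ v ∈ (∅ : Finset I), M v s t) =
        Matrix.gram ℂ (fun _ : S => (1 : ℂ)) := by ext; simp
    rw [this]
    exact posSemidef_gram _
  | insert a F ha ih =>
    have : (Matrix.of fun s t => ∏ v ∈ insert a F, M v s t) =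
        (M a).hadamard (Matrix.of fun s t => ∏ v ∈ F, M v s t) := by
      ext; simp [Finset.prod_insert ha]
    rw [this]
    exact (h a).hadamard ih

lemma posSemidef_prod_sub (F : Finset I) {M N : I → Matrix S S ℂ} {c : I → ℝ}
    (hc : ∀ v, 0 ≤ c v) (hM : ∀ v, (M v).PosSemidef) (hN : ∀ v, (N v).PosSemidef)
    (h : ∀ v, ((c v : ℂ) • N v - M v).PosSemidef) :
    (((∏ v ∈ F, c v : ℝ) : ℂ) • (Matrix.of fun s t => ∏ v ∈ F, N v s t) -
      Matrix.of fun s t => ∏ v ∈ F, M v s t).PosSemidef := by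
  classical
  induction F using Finset.induction_on with
  | empty => simp [Matrix.PosSemidef.zero]
  | insert a F ha ih =>
    have : (((∏ v ∈ insert a F, c v : ℝ) : ℂ) •
          (Matrix.of fun s t => ∏ v ∈ insert a F, N v s t) -
        Matrix.of fun s t => ∏ v ∈ insert a F, M v s t) =
        ((c a : ℂ) • N a - M a).hadamard
          (((∏ v ∈ F, c v : ℝ) : ℂ) • (Matrix.of fun s t => ∏ v ∈ F, N v s t)) +
        (M a).hadamard (((∏ v ∈ F, c v : ℝ) : ℂ) • (Matrix.of fun s t => ∏ v ∈ F, N v s t) -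
          Matrix.of fun s t => ∏ v ∈ F, M v s t) := by
      ext s t
      simp [Finset.prod_insert ha]
      ring
    rw [this]
    refine ((h a).hadamard ((posSemidef_prod F hN).smul ?_)).add ((hM a).hadamard ih)
    have := Finset.prod_nonneg (s := F) fun v _ => hc v
    exact_mod_cast this

/-- The sum defining the form only involves finitely many factors of an infinite product. -/
lemma kernelForm_finprod {M : I → Matrix S S ℂ} {s : Finset S} {F : Finset I}
    (hF : ∀ i ∈ s, ∀ j ∈ s, ∀ v ∉ F, M v i j = 1) {f g : S →₀ ℂ} (hf : f.support ⊆ s)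
    (hg : g.support ⊆ s) :
    kernelForm (Matrix.of fun s t => ∏ᶠ v, M v s t) f g =
      kernelForm (Matrix.of fun s t => ∏ v ∈ F, M v s t) f g := by
  refine Finset.sum_congr rfl fun i hi => Finset.sum_congr rfl fun j hj => ?_
  simp only [Matrix.of_apply]
  rw [finprod_eq_prod_of_mulSupport_subset]
  intro v hv
  by_contra h
  exact hv (hF i (hf hi) j (hg hj) v h)

lemma exists_finset_prod {M : I → Matrix S S ℂ}
    (h1 : ∀ s t, ∀ᶠ v in cofinite, M v s t = 1) (s : Finset S) :
    ∃ F : Finset I, ∀ i ∈ s, ∀ j ∈ s, ∀ v ∉ F, M v i j = 1 := by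
  have : ∀ᶠ v in cofinite, ∀ i ∈ s, ∀ j ∈ s, M v i j = 1 := by
    simp only [Filter.eventually_all_finset]
    exact fun i _ j _ => h1 i j
  refine ⟨(Filter.eventually_cofinite.1 this).toFinset, fun i hi j hj v hv => ?_⟩
  simp only [Set.Finite.mem_toFinset, Set.mem_ofPred_eq, not_not] at hv
  exact hv i hi j hj

lemma posSemidef_finprod {M : I → Matrix S S ℂ} (h : ∀ v, (M v).PosSemidef)
    (h1 : ∀ s t, ∀ᶠ v in cofinite, M v s t = 1) :
    (Matrix.of fun s t => ∏ᶠ v, M v s t).PosSemidef := by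
  classical
  refine (posSemidef_iff_kernelForm _).2 ⟨?_, fun f => ?_⟩
  · ext s t
    obtain ⟨F, hF⟩ := exists_finset_prod h1 {s, t}
    have e : ∀ i ∈ ({s, t} : Finset S), ∀ j ∈ ({s, t} : Finset S),
        ∏ᶠ v, M v i j = ∏ v ∈ F, M v i j := fun i hi j hj => by
      refine finprod_eq_prod_of_mulSupport_subset _ fun v hv => ?_
      by_contra h
      exact hv (hF i hi j hj v h)
    simp only [Matrix.conjTranspose_apply, Matrix.of_apply]
    rw [e t (by simp) s (by simp), e s (by simp) t (by simp), star_prod]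
    exact Finset.prod_congr rfl fun v _ => (h v).isHermitian.apply s t
  · obtain ⟨F, hF⟩ := exists_finset_prod h1 f.support
    rw [kernelForm_finprod hF subset_rfl subset_rfl]
    exact ((posSemidef_iff_kernelForm _).1 (posSemidef_prod F h)).2 f

lemma kernelForm_finprod_le {M N : I → Matrix S S ℂ} {c : I → ℝ}
    (hc : ∀ v, 0 ≤ c v) (hM : ∀ v, (M v).PosSemidef) (hN : ∀ v, (N v).PosSemidef)
    (h : ∀ v, ((c v : ℂ) • N v - M v).PosSemidef)
    (hM1 : ∀ s t, ∀ᶠ v in cofinite, M v s t = 1) (hN1 : ∀ s t, ∀ᶠ v in cofinite, N v s t = 1)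
    (hc1 : ∀ᶠ v in cofinite, c v = 1) (f : S →₀ ℂ) :
    kernelForm (Matrix.of fun s t => ∏ᶠ v, M v s t) f f ≤
      ((∏ᶠ v, c v : ℝ) : ℂ) * kernelForm (Matrix.of fun s t => ∏ᶠ v, N v s t) f f := by
  classical
  obtain ⟨F, hF⟩ := exists_finset_prod hM1 f.support
  obtain ⟨G, hG⟩ := exists_finset_prod hN1 f.support
  obtain ⟨E, hE⟩ : ∃ E : Finset I, ∀ v ∉ E, c v = 1 :=
    ⟨(Filter.eventually_cofinite.1 hc1).toFinset, fun v hv => by simpa using hv⟩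
  let U := F ∪ G ∪ E
  rw [kernelForm_finprod (F := U) (fun i hi j hj v hv => hF i hi j hj v (by simp_all [U]))
      subset_rfl subset_rfl,
    kernelForm_finprod (F := U) (fun i hi j hj v hv => hG i hi j hj v (by simp_all [U]))
      subset_rfl subset_rfl,
    finprod_eq_prod_of_mulSupport_subset (s := U) c (fun v hv => by
      by_contra h; exact hv (hE v (by simp_all [U])))]
  have := ((posSemidef_iff_kernelForm _).1 (posSemidef_prod_sub U hc hM hN h)).2 f
  rw [← sub_nonneg]
  refine this.trans_eq ?_
  simp only [kernelForm, Finsupp.sum, Finset.mul_sum, ← Finset.sum_sub_distrib,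
    Matrix.sub_apply, Matrix.smul_apply, Matrix.of_apply, smul_eq_mul]
  refine Finset.sum_congr rfl fun s _ => Finset.sum_congr rfl fun t _ => ?_
  ring

end Hadamard

section Hilbert

variable {H H' H'' : I → Type*}
  [∀ v, NormedAddCommGroup (H v)] [∀ v, InnerProductSpace ℂ (H v)]
  [∀ v, NormedAddCommGroup (H' v)] [∀ v, InnerProductSpace ℂ (H' v)]
  [∀ v, NormedAddCommGroup (H'' v)] [∀ v, InnerProductSpace ℂ (H'' v)]

/-- The inner products of simple tensors: `⟪⊗ e_v, ⊗ f_v⟫ = ∏ ⟪e_v, f_v⟫`. All but finitely many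
factors are `⟪h_v, h_v⟫ = 1`. -/
def tensorKernel (h : ∀ v, H v) :
    Matrix (RestrictedFamily H h) (RestrictedFamily H h) ℂ :=
  Matrix.of fun e f => ∏ᶠ v, inner ℂ (e v) (f v)

lemma inner_eventually_one {h : ∀ v, H v} (hn : ∀ᶠ v in cofinite, ‖h v‖ = 1)
    (e f : RestrictedFamily H h) : ∀ᶠ v in cofinite, inner ℂ (e v) (f v) = 1 := by
  filter_upwards [hn, e.2, f.2] with v h0 h1 h2
  rw [h1, h2, inner_self_eq_norm_sq_to_K, h0]
  simp

lemma tensorKernel_posSemidef {h : ∀ v, H v} (hn : ∀ᶠ v in cofinite, ‖h v‖ = 1) :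
    (tensorKernel h).PosSemidef :=
  posSemidef_finprod (M := fun v => Matrix.gram ℂ fun e : RestrictedFamily H h => e v)
    (fun _ => posSemidef_gram _) (inner_eventually_one hn)

/-- The restricted tensor product `⊗' (H_v, h_v)` of Hilbert spaces, where `h_v` is a unit vector
for all but finitely many `v`: the completion of the span of the simple tensors `⊗ e_v`, with
`e_v = h_v` for all but finitely many `v`, for the inner product determined by
`⟪⊗ e_v, ⊗ f_v⟫ = ∏ ⟪e_v, f_v⟫`. -/
abbrev HilbertTensor (h : ∀ v, H v) (hn : ∀ᶠ v in cofinite, ‖h v‖ = 1) : Type _ :=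
  KernelSpace (tensorKernel h) (tensorKernel_posSemidef hn)

/-- The simple tensor `⊗ e_v`. -/
def hilbertTmul {h : ∀ v, H v} (hn : ∀ᶠ v in cofinite, ‖h v‖ = 1) (e : RestrictedFamily H h) :
    HilbertTensor h hn :=
  kernelVec _ _ e

lemma inner_hilbertTmul {h : ∀ v, H v} (hn : ∀ᶠ v in cofinite, ‖h v‖ = 1)
    (e f : RestrictedFamily H h) :
    inner ℂ (hilbertTmul hn e) (hilbertTmul hn f) = ∏ᶠ v, inner ℂ (e v) (f v) :=
  inner_kernelVec _ _ e f

/-- The restricted tensor product `⊗' T_v` of bounded operators with `T_v h_v = h'_v` for all but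
finitely many `v`, determined by `(⊗' T_v) (⊗ e_v) = ⊗ T_v e_v`. It is bounded as soon as
`‖T_v‖ ≤ 1` for all but finitely many `v`. -/
def hilbertTensorMap {h : ∀ v, H v} (hn : ∀ᶠ v in cofinite, ‖h v‖ = 1)
    {h' : ∀ v, H' v} (hn' : ∀ᶠ v in cofinite, ‖h' v‖ = 1) (T : ∀ v, H v →L[ℂ] H' v)
    (hT : ∀ᶠ v in cofinite, T v (h v) = h' v) : HilbertTensor h hn →L[ℂ] HilbertTensor h' hn' :=
  kernelLift _ _ fun e => hilbertTmul hn' (e.map (fun v => T v) hT)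

variable {h : ∀ v, H v} {hn : ∀ᶠ v in cofinite, ‖h v‖ = 1}
    {h' : ∀ v, H' v} {hn' : ∀ᶠ v in cofinite, ‖h' v‖ = 1} {T : ∀ v, H v →L[ℂ] H' v}
    {hT : ∀ᶠ v in cofinite, T v (h v) = h' v}

lemma posSemidef_norm_sub {S : Type*} {E E' : Type*} [NormedAddCommGroup E] [InnerProductSpace ℂ E]
    [NormedAddCommGroup E'] [InnerProductSpace ℂ E'] (T : E →L[ℂ] E') {c : ℝ} (hc : ‖T‖ ≤ c)
    (e : S → E) :
    (((c ^ 2 : ℝ) : ℂ) • Matrix.gram ℂ e - Matrix.gram ℂ fun s => T (e s)).PosSemidef := by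
  refine (posSemidef_iff_kernelForm _).2 ⟨?_, fun f => ?_⟩
  · refine Matrix.IsHermitian.sub ?_ (Matrix.isHermitian_gram _ _)
    exact (Matrix.isHermitian_gram ℂ e).smul (by simp [IsSelfAdjoint])
  · have e1 : kernelForm (((c ^ 2 : ℝ) : ℂ) • Matrix.gram ℂ e - Matrix.gram ℂ fun s => T (e s)) f f
        = ((c ^ 2 : ℝ) : ℂ) * kernelForm (Matrix.gram ℂ e) f f -
          kernelForm (Matrix.gram ℂ fun s => T (e s)) f f := by
      simp only [kernelForm, Finsupp.sum, Finset.mul_sum, ← Finset.sum_sub_distrib,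
        Matrix.sub_apply, Matrix.smul_apply, smul_eq_mul]
      refine Finset.sum_congr rfl fun s _ => Finset.sum_congr rfl fun t _ => ?_
      ring
    have e2 : Finsupp.linearCombination ℂ (fun s => T (e s)) f =
        T (Finsupp.linearCombination ℂ e f) := by
      simp [Finsupp.linearCombination_apply, Finsupp.sum, map_sum]
    rw [e1, kernelForm_gram, kernelForm_gram, e2, inner_self_eq_norm_sq_to_K,
      inner_self_eq_norm_sq_to_K]
    have h3 : ‖T (Finsupp.linearCombination ℂ e f)‖ ^ 2 ≤
        c ^ 2 * ‖Finsupp.linearCombination ℂ e f‖ ^ 2 := by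
      rw [← mul_pow]
      gcongr
      exact T.le_of_opNorm_le hc _
    rw [sub_nonneg]
    simp only [Complex.coe_algebraMap]
    exact_mod_cast h3

lemma hilbertTensorMap_bound {c : I → ℝ} (hc : ∀ v, ‖T v‖ ≤ c v)
    (hc1 : ∀ᶠ v in cofinite, c v = 1) (f : RestrictedFamily H h →₀ ℂ) :
    ‖Finsupp.linearCombination ℂ
        (fun e : RestrictedFamily H h => hilbertTmul hn' (e.map (fun v => T v) hT)) f‖
      ≤ (∏ᶠ v, c v) * ‖kernelLin _ (tensorKernel_posSemidef hn) f‖ := by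
  have hc0 : ∀ v, 0 ≤ c v := fun v => (norm_nonneg _).trans (hc v)
  have key := kernelForm_finprod_le (c := fun v => c v ^ 2)
    (M := fun v => Matrix.gram ℂ fun e : RestrictedFamily H h => T v (e v))
    (N := fun v => Matrix.gram ℂ fun e : RestrictedFamily H h => e v)
    (fun v => sq_nonneg _) (fun _ => posSemidef_gram _) (fun _ => posSemidef_gram _)
    (fun v => posSemidef_norm_sub (T v) (hc v) _)
    (fun e f => inner_eventually_one hn' (e.map (fun v => T v) hT) (f.map (fun v => T v) hT))
    (inner_eventually_one hn) (by filter_upwards [hc1] with v hv; simp [hv]) f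
  have e1 : kernelForm (Matrix.of fun s t => ∏ᶠ v,
      Matrix.gram ℂ (fun e : RestrictedFamily H h => T v (e v)) s t) f f =
      ((‖Finsupp.linearCombination ℂ
        (fun e : RestrictedFamily H h =>
          hilbertTmul hn' (e.map (fun v => T v) hT)) f‖ ^ 2 : ℝ) : ℂ) := by
    have := kernelForm_gram
      (fun e : RestrictedFamily H h => hilbertTmul hn' (e.map (fun v => T v) hT)) f f
    rw [inner_self_eq_norm_sq_to_K] at this
    simp only [Complex.coe_algebraMap] at this
    push_cast
    rw [← this]
    congr 1
    ext s t
    exact (inner_hilbertTmul hn' (s.map (fun v => T v) hT) (t.map (fun v => T v) hT)).symm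
  have e2 : kernelForm (Matrix.of fun s t => ∏ᶠ v,
      Matrix.gram ℂ (fun e : RestrictedFamily H h => e v) s t) f f =
      ((‖kernelLin _ (tensorKernel_posSemidef hn) f‖ ^ 2 : ℝ) : ℂ) := by
    have := inner_kernelLin (tensorKernel h) (tensorKernel_posSemidef hn) f f
    rw [inner_self_eq_norm_sq_to_K] at this
    simp only [Complex.coe_algebraMap] at this
    push_cast
    rw [this]
    rfl
  have e3 : ∏ᶠ v, c v ^ 2 = (∏ᶠ v, c v) ^ 2 :=
    (finprod_pow (Filter.eventually_cofinite.1 hc1) 2).symm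
  rw [e1, e2, e3, ← Complex.ofReal_mul, Complex.real_le_real, ← mul_pow] at key
  refine le_of_sq_le_sq key (mul_nonneg (finprod_nonneg hc0) (norm_nonneg _))

lemma hilbertTensorMap_tmul (h1 : ∀ᶠ v in cofinite, ‖T v‖ ≤ 1) (e : RestrictedFamily H h) :
    hilbertTensorMap hn hn' T hT (hilbertTmul hn e) =
      hilbertTmul hn' (e.map (fun v => T v) hT) :=
  kernelLift_apply (hilbertTensorMap_bound (hn := hn) (c := fun v => max 1 ‖T v‖)
    (fun _ => le_max_right _ _) (by filter_upwards [h1] with v hv; simp [hv])) e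

lemma hilbertTensorMap_norm_le {c : I → ℝ} (hc : ∀ v, ‖T v‖ ≤ c v)
    (hc1 : ∀ᶠ v in cofinite, c v = 1) : ‖hilbertTensorMap hn hn' T hT‖ ≤ ∏ᶠ v, c v :=
  kernelLift_norm_le (finprod_nonneg fun v => (norm_nonneg _).trans (hc v))
    (hilbertTensorMap_bound (hn := hn) hc hc1)

lemma hilbert_ext {E : Type*} [NormedAddCommGroup E] [NormedSpace ℂ E]
    {A B : HilbertTensor h hn →L[ℂ] E} (hAB : ∀ e, A (hilbertTmul hn e) = B (hilbertTmul hn e)) :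
    A = B := kernel_ext hAB

lemma hilbertTensorMap_comp {h'' : ∀ v, H'' v} {hn'' : ∀ᶠ v in cofinite, ‖h'' v‖ = 1}
    {R : ∀ v, H' v →L[ℂ] H'' v} {hR : ∀ᶠ v in cofinite, R v (h' v) = h'' v}
    {hRT : ∀ᶠ v in cofinite, (R v ∘L T v) (h v) = h'' v}
    (hT1 : ∀ᶠ v in cofinite, ‖T v‖ ≤ 1) (hR1 : ∀ᶠ v in cofinite, ‖R v‖ ≤ 1) :
    hilbertTensorMap hn' hn'' R hR ∘L hilbertTensorMap hn hn' T hT =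
      hilbertTensorMap hn hn'' (fun v => R v ∘L T v) hRT := by
  refine hilbert_ext fun e => ?_
  rw [hilbertTensorMap_tmul, ContinuousLinearMap.comp_apply, hilbertTensorMap_tmul hT1,
    hilbertTensorMap_tmul hR1]
  · rfl
  · filter_upwards [hT1, hR1] with v h2 h3
    exact (ContinuousLinearMap.opNorm_comp_le _ _).trans (mul_le_one₀ h3 (norm_nonneg _) h2)

lemma hilbertTensorMap_adjoint [∀ v, CompleteSpace (H v)] [∀ v, CompleteSpace (H' v)]
    (hT1 : ∀ᶠ v in cofinite, ‖T v‖ ≤ 1)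
    {hT' : ∀ᶠ v in cofinite, ContinuousLinearMap.adjoint (T v) (h' v) = h v} :
    ContinuousLinearMap.adjoint (hilbertTensorMap hn hn' T hT) =
      hilbertTensorMap hn' hn (fun v => ContinuousLinearMap.adjoint (T v)) hT' := by
  refine kernel_inner_ext fun s t => ?_
  change inner ℂ (hilbertTensorMap hn' hn _ hT' (hilbertTmul hn' s)) (hilbertTmul hn t) =
    inner ℂ (hilbertTmul hn' s) (hilbertTensorMap hn hn' T hT (hilbertTmul hn t))
  rw [hilbertTensorMap_tmul hT1, hilbertTensorMap_tmul, inner_hilbertTmul, inner_hilbertTmul]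
  · exact finprod_congr fun v => ContinuousLinearMap.adjoint_inner_left _ _ _
  · filter_upwards [hT1] with v hv
    simpa using hv

/-- The restricted tensor product of operators is determined by its factors. -/
lemma hilbertTensorMap_congr {T' : ∀ v, H v →L[ℂ] H' v} (e : T = T')
    (hT' : ∀ᶠ v in cofinite, T' v (h v) = h' v) :
    hilbertTensorMap hn hn' T hT = hilbertTensorMap hn hn' T' hT' := by
  subst e; rfl

end Hilbert
end Restricted


/-! ### Hilbert modules, correspondences, interior tensor products -/

section Modules

/-- A (right) Hilbert `C⋆`-module over a `C⋆`-algebra `A`: a right `A`-module `X` with an `A`-valued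
inner product, `A`-linear in the second variable, such that `‖x‖² = ‖⟪x, x⟫‖`. Completeness is the
separate class `CompleteSpace X`. An element of a `C⋆`-algebra is positive if and only if it is of
the form `a⋆ a`. -/
class RightHilbertModule (A : Type*) (X : Type*) [NonUnitalCStarAlgebra A]
    [NormedAddCommGroup X] [NormedSpace ℂ X] extends Inner A X where
  /-- The right action of `A` on `X`. -/
  act : X → A → X
  add_act : ∀ x y a, act (x + y) a = act x a + act y a
  act_add : ∀ x a b, act x (a + b) = act x a + act x b
  act_mul : ∀ x a b, act x (a * b) = act (act x a) b
  smul_act : ∀ (c : ℂ) x a, act (c • x) a = c • act x a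
  act_smul : ∀ (c : ℂ) x a, act x (c • a) = c • act x a
  inner_add_right : ∀ x y z, inner x (y + z) = inner x y + inner x z
  inner_smul_right : ∀ (c : ℂ) x y, inner x (c • y) = c • inner x y
  inner_act_right : ∀ x y a, inner x (act y a) = inner x y * a
  star_inner : ∀ x y, star (inner x y) = inner y x
  inner_self_nonneg : ∀ x, ∃ a : A, inner x x = star a * a
  norm_sq_eq : ∀ x, ‖x‖ ^ 2 = ‖inner x x‖

namespace RightHilbertModule

variable {A X : Type*} [NonUnitalCStarAlgebra A] [NormedAddCommGroup X] [NormedSpace ℂ X]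
  [RightHilbertModule A X]

lemma inner_add_left (x y z : X) : inner A (x + y) z = inner A x z + inner A y z := by
  rw [← star_inner z, inner_add_right, star_add, star_inner, star_inner]

lemma inner_smul_left (c : ℂ) (x y : X) : inner A (c • x) y = conj c • inner A x y := by
  rw [← star_inner y, inner_smul_right, star_smul, star_inner]; rfl

lemma inner_act_left (x y : X) (a : A) : inner A (act x a) y = star a * inner A x y := by
  rw [← star_inner y, inner_act_right, star_mul, star_inner]

variable (A) in
/-- The inner product, as a linear map in the second variable. -/
def innerLin (x : X) : X →ₗ[ℂ] A where
  toFun := inner A x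
  map_add' := inner_add_right x
  map_smul' c y := inner_smul_right c x y

lemma inner_sum_right {ι : Type*} (s : Finset ι) (x : X) (y : ι → X) :
    inner A x (∑ i ∈ s, y i) = ∑ i ∈ s, inner A x (y i) := map_sum (innerLin A x) y s

lemma inner_sum_left {ι : Type*} (s : Finset ι) (x : X) (y : ι → X) :
    inner A (∑ i ∈ s, y i) x = ∑ i ∈ s, inner A (y i) x := by
  rw [← star_inner x, inner_sum_right, star_sum]
  simp [star_inner]

lemma inner_sub_right (x y z : X) : inner A x (y - z) = inner A x y - inner A x z :=
  map_sub (innerLin A x) y z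

lemma inner_sub_left (x y z : X) : inner A (x - y) z = inner A x z - inner A y z := by
  rw [← star_inner z, inner_sub_right, star_sub, star_inner, star_inner]

lemma norm_act_le (x : X) (a : A) : ‖act x a‖ ≤ ‖x‖ * ‖a‖ := by
  refine le_of_sq_le_sq ?_ (by positivity)
  rw [norm_sq_eq (A := A), inner_act_right, inner_act_left, mul_pow, norm_sq_eq (A := A)]
  calc _ ≤ ‖star a‖ * ‖inner A x x‖ * ‖a‖ :=
        (norm_mul_le _ _).trans (mul_le_mul_of_nonneg_right (norm_mul_le _ _) (norm_nonneg _))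
    _ = _ := by rw [norm_star]; ring

/-- The Cauchy–Schwarz inequality. -/
lemma norm_inner_le (x y : X) : ‖inner A x y‖ ≤ ‖x‖ * ‖y‖ := by
  let _ := CStarAlgebra.spectralOrder A
  let _ := CStarAlgebra.spectralOrderedRing A
  rcases eq_or_ne x 0 with rfl | hx
  · have : inner A (0 : X) y = 0 := by simpa using inner_smul_left (A := A) 0 (0 : X) y
    simp [this]
  have hx' : 0 < ‖x‖ ^ 2 := by positivity
  set a := inner A x y with ha
  have hya : inner A y x = star a := (star_inner x y).symm
  set r : ℝ := ‖x‖ ^ 2 with hr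
  obtain ⟨b, hb⟩ := inner_self_nonneg (A := A) (act x a - (r : ℂ) • y)
  have h0 : 0 ≤ star a * inner A x x * a - r • (star a * a) - r • (star a * a) +
      r • r • inner A y y := by
    have : star a * inner A x x * a - r • (star a * a) - r • (star a * a) +
      r • r • inner A y y = star b * b := by
      rw [← hb]
      simp only [inner_sub_right, inner_sub_left, inner_act_right, inner_act_left,
        inner_smul_right, inner_smul_left, hya, ← ha, Complex.conj_ofReal,
        smul_mul_assoc, sub_mul]
      simp only [Complex.coe_smul, smul_sub]
      abel
    rw [this]
    exact star_mul_self_nonneg b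
  have h1 : star a * inner A x x * a ≤ r • (star a * a) := by
    rw [hr, norm_sq_eq (A := A)]
    refine CStarAlgebra.star_left_conjugate_le_norm_smul ?_
    exact star_inner x x
  have h2 : r • (star a * a) ≤ r • r • inner A y y := by
    rw [← sub_nonneg]
    refine h0.trans ?_
    rw [← sub_nonneg] at h1 ⊢
    refine h1.trans_eq ?_
    abel
  have h3 : star a * a ≤ r • inner A y y := (smul_le_smul_iff_of_pos_left hx').1 h2
  have h4 := CStarAlgebra.norm_le_norm_of_nonneg_of_le (star_mul_self_nonneg a) h3
  rw [CStarRing.norm_star_mul_self, norm_smul, ← norm_sq_eq, hr, norm_pow, norm_norm] at h4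
  refine le_of_sq_le_sq ?_ (by positivity)
  rw [mul_pow, sq ‖a‖]
  exact h4

variable (A) in
/-- The rank one operator `z ↦ x ⟪y, z⟫`. -/
def rankOne (x y : X) : X →L[ℂ] X :=
  LinearMap.mkContinuous
    { toFun := fun z => act x (inner A y z)
      map_add' := fun z w => by rw [inner_add_right, act_add]
      map_smul' := fun c z => by rw [inner_smul_right, act_smul]; rfl }
    (‖x‖ * ‖y‖) fun z => by
      refine (norm_act_le x (inner A y z)).trans ?_
      rw [mul_assoc]
      exact mul_le_mul_of_nonneg_left (norm_inner_le y z) (norm_nonneg _)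

@[simp] lemma rankOne_apply (x y z : X) : rankOne A x y z = act x (inner A y z) := rfl

variable (A X) in
/-- The `A`-compact operators `𝕂_A(X)`: the norm closure of the span of the rank one operators. -/
def compactOperators : Submodule ℂ (X →L[ℂ] X) :=
  (Submodule.span ℂ (Set.range fun x : X × X => rankOne A x.1 x.2)).topologicalClosure

variable (A) in
/-- `S` is an adjoint of the operator `T` on the Hilbert module `X`. The operators `T` which have an
adjoint form the `C⋆`-algebra `End*_A(X)` of adjointable operators, with `T⋆ = S`. -/
def IsAdjointPair (T S : X →L[ℂ] X) : Prop := ∀ x y : X, inner A (T x) y = inner A x (S y)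

lemma exists_negPart {B : Type*} [NonUnitalCStarAlgebra B] (M : B) (hM : IsSelfAdjoint M) :
    ∃ N r : B, IsSelfAdjoint N ∧ N = star r * r ∧ M * N = - (N * N) ∧
      (N = 0 → ∃ R : B, M = star R * R) := by
  let _ := CStarAlgebra.spectralOrder B
  let _ := CStarAlgebra.spectralOrderedRing B
  have hN0 : 0 ≤ M⁻ := CFC.negPart_nonneg M
  obtain ⟨r, hr⟩ := CStarAlgebra.nonneg_iff_eq_star_mul_self.1 hN0
  refine ⟨M⁻, r, IsSelfAdjoint.of_nonneg hN0, hr, ?_, fun h5 => ?_⟩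
  · nth_rewrite 1 [← CFC.posPart_sub_negPart M hM]
    rw [sub_mul, CFC.posPart_mul_negPart, zero_sub]
  · refine CStarAlgebra.nonneg_iff_eq_star_mul_self.1 ?_
    rw [← CFC.posPart_sub_negPart M hM, h5, sub_zero]
    exact CFC.posPart_nonneg M

/-- The matrix of inner products of finitely many elements of a Hilbert module is positive. -/
lemma exists_gram_factor {n : Type*} [Fintype n] [DecidableEq n] (x : n → X) :
    ∃ R : n → n → A, ∀ i j, inner A (x i) (x j) = ∑ k, star (R k i) * R k j := by
  let _ := CStarAlgebra.spectralOrder A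
  let _ := CStarAlgebra.spectralOrderedRing A
  let M : CStarMatrix n n A := CStarMatrix.ofMatrix (Matrix.of fun i j => inner A (x i) (x j))
  have hM : IsSelfAdjoint M := by
    ext i j
    exact star_inner (A := A) _ _
  obtain ⟨N, r, hNs, hr, hMN, hN⟩ := exists_negPart M hM
  have h1 : star N * M * N + star (r * N) * (r * N) = 0 := by
    rw [mul_assoc, hMN, star_mul, mul_assoc (star N), ← mul_assoc (star r), ← hr]
    simp
  have h2 : ∀ i k, (r * N) k i = 0 := by
    intro i
    have h3 : (star N * M * N) i i + (star (r * N) * (r * N)) i i = 0 := congr($h1 i i)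
    have h4 : (star N * M * N) i i =
        inner A (∑ k, act (x k) (N k i)) (∑ k, act (x k) (N k i)) := by
      simp only [inner_sum_left, inner_sum_right, inner_act_right, inner_act_left]
      rw [CStarMatrix.mul_apply]
      simp only [CStarMatrix.mul_apply, Finset.sum_mul]
      rfl
    have h5 : (star (r * N) * (r * N)) i i = ∑ k, star ((r * N) k i) * (r * N) k i := by
      rw [CStarMatrix.mul_apply]; rfl
    obtain ⟨b, hb⟩ := inner_self_nonneg (A := A) (∑ k, act (x k) (N k i))
    rw [h4, h5, hb] at h3
    have h6 : 0 ≤ ∑ k, star ((r * N) k i) * (r * N) k i :=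
      Finset.sum_nonneg fun k _ => star_mul_self_nonneg _
    have h7 := ((add_eq_zero_iff_of_nonneg (star_mul_self_nonneg b) h6).1 h3).2
    intro k
    have h8 := (Finset.sum_eq_zero_iff_of_nonneg
      (fun k _ => star_mul_self_nonneg ((r * N) k i))).1 h7 k (Finset.mem_univ k)
    exact CStarRing.star_mul_self_eq_zero_iff _ |>.1 h8
  have h3 : r * N = 0 := by ext k i; exact h2 i k
  have h4 : star N * N = 0 := by
    rw [hNs.star_eq]
    conv_lhs => enter [1]; rw [hr]
    rw [mul_assoc, h3, mul_zero]
  have h5 : N = 0 := (CStarRing.star_mul_self_eq_zero_iff _).1 h4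
  obtain ⟨R, hR⟩ := hN h5
  refine ⟨fun k j => R k j, fun i j => ?_⟩
  have : M i j = (star R * R) i j := congr($hR i j)
  rw [CStarMatrix.mul_apply] at this
  exact this

end RightHilbertModule

open RightHilbertModule

/-- A `C⋆`-correspondence structure on the Hilbert `A`-module `X`: a `⋆`-homomorphism from `A'` to
the adjointable operators `End*_A(X)`, that is, a homomorphism `α` of algebras such that `α(a⋆)` is
the adjoint of `α(a)`. -/
structure Correspondence (A' A X : Type*) [NonUnitalCStarAlgebra A'] [NonUnitalCStarAlgebra A]
    [NormedAddCommGroup X] [NormedSpace ℂ X] [RightHilbertModule A X] where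
  /-- The underlying homomorphism of algebras. -/
  toAlgHom : A' →ₙₐ[ℂ] (X →L[ℂ] X)
  adjoint : ∀ a : A', IsAdjointPair A (toAlgHom a) (toAlgHom (star a))

instance (A' A X : Type*) [NonUnitalCStarAlgebra A'] [NonUnitalCStarAlgebra A]
    [NormedAddCommGroup X] [NormedSpace ℂ X] [RightHilbertModule A X] :
    CoeFun (Correspondence A' A X) (fun _ => A' → (X →L[ℂ] X)) :=
  ⟨fun α => α.toAlgHom⟩

section Interior

variable {A X H : Type*} [NonUnitalCStarAlgebra A] [NormedAddCommGroup X] [NormedSpace ℂ X]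
  [RightHilbertModule A X] [NormedAddCommGroup H] [InnerProductSpace ℂ H] [CompleteSpace H]

/-- The inner products `⟪x ⊗ h, y ⊗ k⟫ = ⟪h, π(⟪x, y⟫) k⟫` of simple tensors. -/
def interiorKernel (X : Type*) [NormedAddCommGroup X] [NormedSpace ℂ X] [RightHilbertModule A X]
    (π : A →⋆ₙₐ[ℂ] (H →L[ℂ] H)) : Matrix (X × H) (X × H) ℂ :=
  Matrix.of fun s t => inner ℂ s.2 (π (inner A s.1 t.1) t.2)

lemma interiorKernel_posSemidef (π : A →⋆ₙₐ[ℂ] (H →L[ℂ] H)) :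
    (interiorKernel X π).PosSemidef := by
  classical
  refine (posSemidef_iff_kernelForm _).2 ⟨?_, fun f => ?_⟩
  · ext s t
    simp only [Matrix.conjTranspose_apply, interiorKernel, Matrix.of_apply, RCLike.star_def]
    rw [inner_conj_symm, ← star_inner (A := A) s.1, map_star, ContinuousLinearMap.star_eq_adjoint,
      ContinuousLinearMap.adjoint_inner_left]
  · obtain ⟨R, hR⟩ := exists_gram_factor (A := A) (fun i : f.support => i.1.1)
    have : kernelForm (interiorKernel X π) f f =
        ∑ k, inner ℂ (∑ i : f.support, π (R k i) (f i • i.1.2))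
          (∑ j : f.support, π (R k j) (f j • j.1.2)) := by
      have e1 : ∀ i j : f.support, conj (f i) * f j * interiorKernel X π i j =
          ∑ k, inner ℂ (π (R k i) (f i • i.1.2)) (π (R k j) (f j • j.1.2)) := by
        intro i j
        simp only [interiorKernel, Matrix.of_apply, hR, map_sum, map_mul, map_star, map_smul,
          _root_.inner_smul_left, _root_.inner_smul_right, ContinuousLinearMap.star_eq_adjoint]
        rw [sum_apply, inner_sum, Finset.mul_sum]
        refine Finset.sum_congr rfl fun k _ => ?_
        rw [mul_apply_eq_comp, ContinuousLinearMap.adjoint_inner_right]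
        ring
      simp only [kernelForm, Finsupp.sum]
      rw [← Finset.sum_coe_sort]
      simp_rw [← Finset.sum_coe_sort f.support, e1, sum_inner, inner_sum]
      conv_rhs => rw [Finset.sum_comm]
      exact Finset.sum_congr rfl fun i _ => Finset.sum_comm
    rw [this]
    refine Finset.sum_nonneg fun k _ => ?_
    rw [inner_self_eq_norm_sq_to_K]
    have h : (0 : ℝ) ≤ ‖∑ i : f.support, π (R k i) (f i • i.1.2)‖ ^ 2 := sq_nonneg _
    simp only [Complex.coe_algebraMap]
    exact_mod_cast h

/-- The interior tensor product `X ⊗_A H` of a Hilbert `A`-module with a representation `(π, H)` of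
`A`: the completion of the span of the simple tensors `x ⊗ h` for the inner product determined by
`⟪x ⊗ h, y ⊗ k⟫ = ⟪h, π(⟪x, y⟫) k⟫`. -/
abbrev InteriorTensor (X : Type*) [NormedAddCommGroup X] [NormedSpace ℂ X] [RightHilbertModule A X]
    (π : A →⋆ₙₐ[ℂ] (H →L[ℂ] H)) : Type _ :=
  KernelSpace (interiorKernel X π) (interiorKernel_posSemidef π)

/-- The simple tensor `x ⊗ h`. -/
def interiorTmul (π : A →⋆ₙₐ[ℂ] (H →L[ℂ] H)) (x : X) (h : H) : InteriorTensor X π :=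
  kernelVec _ _ (x, h)

variable (π : A →⋆ₙₐ[ℂ] (H →L[ℂ] H))

lemma inner_interiorTmul (x y : X) (h k : H) :
    inner ℂ (interiorTmul π x h) (interiorTmul π y k) = inner ℂ h (π (inner A x y) k) :=
  inner_kernelVec _ _ _ _

lemma interior_vec_ext {u v : InteriorTensor X π}
    (huv : ∀ x h, inner ℂ (interiorTmul π x h) u = inner ℂ (interiorTmul π x h) v) : u = v :=
  kernelVec_ext fun s => huv s.1 s.2

lemma interior_ext {E : Type*} [NormedAddCommGroup E] [NormedSpace ℂ E]
    {S T : InteriorTensor X π →L[ℂ] E}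
    (hST : ∀ x h, S (interiorTmul π x h) = T (interiorTmul π x h)) : S = T :=
  kernel_ext fun s => hST s.1 s.2

lemma add_interiorTmul (x y : X) (h : H) :
    interiorTmul π (x + y) h = interiorTmul π x h + interiorTmul π y h := by
  refine interior_vec_ext π fun z k => ?_
  simp [inner_interiorTmul, RightHilbertModule.inner_add_right]

lemma smul_interiorTmul (c : ℂ) (x : X) (h : H) :
    interiorTmul π (c • x) h = c • interiorTmul π x h := by
  refine interior_vec_ext π fun z k => ?_
  simp [inner_interiorTmul, RightHilbertModule.inner_smul_right]

lemma interiorTmul_add (x : X) (h k : H) :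
    interiorTmul π x (h + k) = interiorTmul π x h + interiorTmul π x k := by
  refine interior_vec_ext π fun z l => ?_
  simp [inner_interiorTmul]

lemma interiorTmul_smul (c : ℂ) (x : X) (h : H) :
    interiorTmul π x (c • h) = c • interiorTmul π x h := by
  refine interior_vec_ext π fun z l => ?_
  simp [inner_interiorTmul]

/-- The interior tensor product is balanced over `A`. -/
lemma act_interiorTmul (x : X) (a : A) (h : H) :
    interiorTmul π (act x a) h = interiorTmul π x (π a h) := by
  refine interior_vec_ext π fun z l => ?_
  simp [inner_interiorTmul, inner_act_right]

lemma norm_interiorTmul_le (x : X) (h : H) : ‖interiorTmul π x h‖ ≤ ‖x‖ * ‖h‖ := by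
  refine le_of_sq_le_sq ?_ (by positivity)
  rw [← inner_self_eq_norm_sq (𝕜 := ℂ), inner_interiorTmul]
  calc _ ≤ ‖inner ℂ h (π (inner A x x) h)‖ := RCLike.re_le_norm _
    _ ≤ ‖h‖ * ‖π (inner A x x) h‖ := norm_inner_le_norm _ _
    _ ≤ ‖h‖ * (‖inner A x x‖ * ‖h‖) := by
      gcongr
      exact ContinuousLinearMap.le_of_opNorm_le _ (NonUnitalStarAlgHom.norm_apply_le π _) _
    _ = (‖x‖ * ‖h‖) ^ 2 := by rw [← norm_sq_eq]; ring

/-- The creation operator `h ↦ x ⊗ h`. -/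
def creation (x : X) : H →L[ℂ] InteriorTensor X π :=
  LinearMap.mkContinuous
    { toFun := interiorTmul π x
      map_add' := interiorTmul_add π x
      map_smul' := fun c h => interiorTmul_smul π c x h } ‖x‖ (norm_interiorTmul_le π x)

@[simp] lemma creation_apply (x : X) (h : H) : creation π x h = interiorTmul π x h := rfl

lemma norm_creation_le (x : X) : ‖creation π x‖ ≤ ‖x‖ :=
  LinearMap.mkContinuous_norm_le _ (norm_nonneg _) _

lemma creation_adjoint_tmul (x y : X) (h : H) :
    ContinuousLinearMap.adjoint (creation π x) (interiorTmul π y h) = π (inner A x y) h := by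
  refine ext_inner_left ℂ fun k => ?_
  rw [ContinuousLinearMap.adjoint_inner_right, creation_apply, inner_interiorTmul]

lemma creation_adjoint_comp (x y : X) :
    ContinuousLinearMap.adjoint (creation π x) ∘L creation π y = π (inner A x y) := by
  ext h
  exact creation_adjoint_tmul π x y h

lemma le_of_pow_le {x q C : ℝ} (hx : 0 ≤ x) (hq : 0 ≤ q)
    (h : ∀ k : ℕ, x ^ 2 ^ k ≤ C * q ^ 2 ^ k) : x ≤ q := by
  by_contra! hlt
  have hx0 : 0 < x := hq.trans_lt hlt
  have h1 : ∀ k : ℕ, 1 ≤ C * (q / x) ^ 2 ^ k := fun k => by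
    rw [div_pow, ← mul_div_assoc, le_div_iff₀ (by positivity), one_mul]
    exact h k
  have h2 : Tendsto (fun k : ℕ => C * (q / x) ^ 2 ^ k) atTop (𝓝 (C * 0)) :=
    ((tendsto_pow_atTop_nhds_zero_of_lt_one (div_nonneg hq hx) ((div_lt_one hx0).2 hlt)).comp
      (tendsto_pow_atTop_atTop_of_one_lt one_lt_two)).const_mul C
  rw [mul_zero] at h2
  exact absurd (ge_of_tendsto' h2 h1) (by norm_num)

/-- The operator `T ⊗ 1` on `X ⊗_A H` (bounded for adjointable `T`). -/
def interiorMap (T : X →L[ℂ] X) : InteriorTensor X π →L[ℂ] InteriorTensor X π :=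
  kernelLift _ _ fun s => interiorTmul π (T s.1) s.2

/-- The algebraic version of `T ⊗ 1`. -/
def preInteriorMap (T : X →L[ℂ] X) : (X × H →₀ ℂ) →ₗ[ℂ] InteriorTensor X π :=
  Finsupp.linearCombination ℂ fun s => interiorTmul π (T s.1) s.2

lemma inner_preInteriorMap {T S T' S' : X →L[ℂ] X}
    (h : ∀ x y : X, inner A (T x) (S y) = inner A (T' x) (S' y)) (f g : X × H →₀ ℂ) :
    inner ℂ (preInteriorMap π T f) (preInteriorMap π S g) =
      inner ℂ (preInteriorMap π T' f) (preInteriorMap π S' g) := by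
  simp only [preInteriorMap, Finsupp.linearCombination_apply, Finsupp.sum, sum_inner, inner_sum,
    _root_.inner_smul_left, _root_.inner_smul_right, inner_interiorTmul, h]

lemma preInteriorMap_one (f : X × H →₀ ℂ) :
    preInteriorMap π 1 f = kernelLin _ (interiorKernel_posSemidef π) f :=
  (kernelLin_eq _ _ f).symm

lemma preInteriorMap_bound {T S : X →L[ℂ] X} (hTS : IsAdjointPair A T S) (f : X × H →₀ ℂ) :
    ‖preInteriorMap π T f‖ ≤ √(‖S‖ * ‖T‖) * ‖kernelLin _ (interiorKernel_posSemidef π) f‖ := by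
  have hST : IsAdjointPair A S T := fun x y => by
    rw [← star_inner y, ← hTS, star_inner]
  set Q : X →L[ℂ] X := S * T
  set q := ‖S‖ * ‖T‖
  have hq : 0 ≤ q := by positivity
  have hQ : ∀ (n : ℕ) (x y : X), inner A ((Q ^ n) x) y = inner A x ((Q ^ n) y) := by
    intro n
    induction n with
    | zero => intro x y; simp
    | succ n ih =>
      intro x y
      rw [pow_succ, mul_apply_eq_comp, ih, ← pow_succ, pow_succ', mul_apply_eq_comp]
      change inner A (S (T x)) _ = inner A x (S (T _))
      rw [hST, hTS]
      rfl
  set C : ℝ := ∑ s ∈ f.support, ‖f s‖ * (‖s.1‖ * ‖s.2‖)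
  have hC : ∀ n, ‖preInteriorMap π (Q ^ n) f‖ ≤ C * q ^ n := by
    intro n
    have hQn : ‖Q ^ n‖ ≤ q ^ n ∨ n = 0 := by
      rcases Nat.eq_zero_or_pos n with h | h
      · exact .inr h
      · exact .inl ((norm_pow_le' Q h).trans (pow_le_pow_left₀ (norm_nonneg _) (norm_mul_le _ _) n))
    have hQn' : ∀ x : X, ‖(Q ^ n) x‖ ≤ q ^ n * ‖x‖ := by
      rcases hQn with h | h
      · exact fun x => ContinuousLinearMap.le_of_opNorm_le _ h x
      · subst h; simp
    rw [preInteriorMap, Finsupp.linearCombination_apply, Finsupp.sum, Finset.sum_mul]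
    refine norm_sum_le_of_le _ fun s _ => ?_
    rw [norm_smul, mul_assoc]
    gcongr
    refine (norm_interiorTmul_le π _ _).trans ?_
    calc _ ≤ q ^ n * ‖s.1‖ * ‖s.2‖ := by gcongr; exact hQn' _
      _ = _ := by ring
  set a : ℕ → ℝ := fun n => ‖preInteriorMap π (Q ^ n) f‖ with ha
  have h1 : ∀ n, a n ^ 2 ≤ a 0 * a (n + n) := by
    intro n
    rw [ha, ← inner_self_eq_norm_sq (𝕜 := ℂ), inner_preInteriorMap π (T' := Q ^ 0)
      (S' := Q ^ (n + n)) (fun x y => by rw [hQ, pow_add]; rfl)]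
    exact re_inner_le_norm _ _
  have h2 : a 1 ≤ q * a 0 := by
    rcases (norm_nonneg _ : 0 ≤ a 0).eq_or_lt with h0 | h0
    · have := h1 1
      have h0' : a 0 = 0 := h0.symm
      rw [h0', zero_mul] at this
      rw [h0', mul_zero]
      exact (pow_eq_zero_iff two_ne_zero).1 (le_antisymm this (sq_nonneg _)) |>.le
    · rw [← div_le_iff₀ h0]
      refine le_of_pow_le (C := C / a 0) (div_nonneg (norm_nonneg _) h0.le) hq fun k => ?_
      have h3 : (a 1 / a 0) ^ 2 ^ k ≤ a (2 ^ k) / a 0 := by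
        induction k with
        | zero => simp
        | succ k ih =>
          rw [pow_succ 2 k, pow_mul]
          calc _ ≤ (a (2 ^ k) / a 0) ^ 2 := by
                gcongr
            _ = a (2 ^ k) ^ 2 / a 0 ^ 2 := div_pow _ _ _
            _ ≤ a 0 * a (2 ^ k + 2 ^ k) / a 0 ^ 2 := by gcongr; exact h1 _
            _ = a (2 ^ k * 2) / a 0 := by rw [mul_two]; field_simp
      refine h3.trans ?_
      rw [div_mul_eq_mul_div]
      gcongr
      exact hC _
  have h4 : ‖preInteriorMap π T f‖ ^ 2 ≤ a 0 * a 1 := by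
    rw [ha, ← inner_self_eq_norm_sq (𝕜 := ℂ), inner_preInteriorMap π (T' := Q ^ 0)
      (S' := Q ^ 1) (fun x y => by rw [pow_one]; exact hTS x (T y))]
    exact re_inner_le_norm _ _
  have h5 : a 0 = ‖kernelLin _ (interiorKernel_posSemidef π) f‖ := by
    rw [← preInteriorMap_one]; rfl
  rw [← h5]
  refine le_of_sq_le_sq ?_ (by positivity)
  rw [mul_pow, Real.sq_sqrt hq]
  calc _ ≤ a 0 * a 1 := h4
    _ ≤ a 0 * (q * a 0) := by gcongr
    _ = _ := by ring

lemma interiorMap_tmul {T S : X →L[ℂ] X} (hTS : IsAdjointPair A T S) (x : X) (h : H) :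
    interiorMap π T (interiorTmul π x h) = interiorTmul π (T x) h :=
  kernelLift_apply (hK := interiorKernel_posSemidef π) (preInteriorMap_bound π hTS) (x, h)

lemma interiorMap_adjoint {T S : X →L[ℂ] X} (hTS : IsAdjointPair A T S) :
    ContinuousLinearMap.adjoint (interiorMap π T) = interiorMap π S := by
  have hST : IsAdjointPair A S T := fun x y => by
    rw [← star_inner y, ← hTS, star_inner]
  refine kernel_inner_ext fun s t => ?_
  change inner ℂ (interiorMap π S (interiorTmul π s.1 s.2)) (interiorTmul π t.1 t.2) =
    inner ℂ (interiorTmul π s.1 s.2) (interiorMap π T (interiorTmul π t.1 t.2))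
  rw [interiorMap_tmul π hTS, interiorMap_tmul π hST, inner_interiorTmul, inner_interiorTmul, hST]

variable {A' : Type*} [NonUnitalCStarAlgebra A']

/-- The representation `α ⊗ 1` of `A'` on `X ⊗_A H` induced from the representation `(π, H)` of `A`
by the correspondence `X`, determined by `(α ⊗ 1)(a) (x ⊗ h) = α(a) x ⊗ h`. -/
def Correspondence.induce (α : Correspondence A' A X) :
    A' →⋆ₙₐ[ℂ] (InteriorTensor X π →L[ℂ] InteriorTensor X π) where
  toFun a := interiorMap π (α a)
  map_smul' c a := interior_ext π fun x h => by
    change _ = c • interiorMap π (α a) (interiorTmul π x h)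
    rw [interiorMap_tmul π (α.adjoint _), interiorMap_tmul π (α.adjoint _), map_smul,
      ← smul_interiorTmul]
    rfl
  map_zero' := interior_ext π fun x h => by
    have := smul_interiorTmul π 0 (0 : X) h
    rw [interiorMap_tmul π (α.adjoint _), map_zero]
    simpa using this
  map_add' a b := interior_ext π fun x h => by
    change _ = interiorMap π (α a) (interiorTmul π x h) + interiorMap π (α b) (interiorTmul π x h)
    rw [interiorMap_tmul π (α.adjoint _), interiorMap_tmul π (α.adjoint _),
      interiorMap_tmul π (α.adjoint _), map_add, ← add_interiorTmul]
    rfl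
  map_mul' a b := interior_ext π fun x h => by
    change _ = interiorMap π (α a) (interiorMap π (α b) (interiorTmul π x h))
    rw [interiorMap_tmul π (α.adjoint _), interiorMap_tmul π (α.adjoint _),
      interiorMap_tmul π (α.adjoint _), map_mul]
    rfl
  map_star' a := (interiorMap_adjoint π (α.adjoint a)).symm

lemma Correspondence.induce_tmul (α : Correspondence A' A X) (a : A') (x : X) (h : H) :
    α.induce π a (interiorTmul π x h) = interiorTmul π (α a x) h :=
  interiorMap_tmul π (α.adjoint a) x h

end Interior
end Modules


/-! ### Bounded families of operators between two families of Hilbert spaces -/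

section LpOps

variable {Θ : Type*} {G H K : Θ → Type*}
  [∀ θ, NormedAddCommGroup (G θ)] [∀ θ, InnerProductSpace ℂ (G θ)]
  [∀ θ, NormedAddCommGroup (H θ)] [∀ θ, InnerProductSpace ℂ (H θ)]
  [∀ θ, NormedAddCommGroup (K θ)] [∀ θ, InnerProductSpace ℂ (K θ)]

/-- The Banach space of bounded families `(T_θ)` of operators `T_θ : H_θ → K_θ`, with the supremum
norm; when `H = K` it is a `C⋆`-algebra. -/
def OpFam {Θ : Type*} (H K : Θ → Type*)
    [∀ θ, NormedAddCommGroup (H θ)] [∀ θ, InnerProductSpace ℂ (H θ)]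
    [∀ θ, NormedAddCommGroup (K θ)] [∀ θ, InnerProductSpace ℂ (K θ)] : Type _ :=
  lp (fun θ => H θ →L[ℂ] K θ) ∞

instance : NormedAddCommGroup (OpFam H K) :=
  inferInstanceAs (NormedAddCommGroup (lp (fun θ => H θ →L[ℂ] K θ) ∞))
instance : NormedSpace ℂ (OpFam H K) :=
  inferInstanceAs (NormedSpace ℂ (lp (fun θ => H θ →L[ℂ] K θ) ∞))
instance [∀ θ, CompleteSpace (K θ)] : CompleteSpace (OpFam H K) :=
  inferInstanceAs (CompleteSpace (lp (fun θ => H θ →L[ℂ] K θ) ∞))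
instance [∀ θ, CompleteSpace (H θ)] : NonUnitalCStarAlgebra (OpFam H H) :=
  inferInstanceAs (NonUnitalCStarAlgebra (lp (fun θ => H θ →L[ℂ] H θ) ∞))
instance : CoeFun (OpFam H K) (fun _ => ∀ θ, H θ →L[ℂ] K θ) := ⟨Subtype.val⟩

/-- A family of operators with a common bound, as an element of `OpFam`. -/
def OpFam.mk (T : ∀ θ, H θ →L[ℂ] K θ) (C : ℝ) (hC : ∀ θ, ‖T θ‖ ≤ C) : OpFam H K :=
  ⟨T, memℓp_infty ⟨C, by rintro _ ⟨θ, rfl⟩; exact hC θ⟩⟩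

@[simp] lemma OpFam.mk_apply (T : ∀ θ, H θ →L[ℂ] K θ) (C : ℝ) (hC : ∀ θ, ‖T θ‖ ≤ C) (θ : Θ) :
    OpFam.mk T C hC θ = T θ := rfl

lemma OpFam.norm_apply_le (T : OpFam H K) (θ : Θ) : ‖T θ‖ ≤ ‖T‖ :=
  lp.norm_apply_le_norm ENNReal.top_ne_zero T θ

lemma OpFam.ext {S T : OpFam H K} (h : ∀ θ, S θ = T θ) : S = T := lp.ext (funext h)

lemma OpFam.comp_bound (S : OpFam H K) (T : OpFam G H) (θ : Θ) :
    ‖S θ ∘L T θ‖ ≤ ‖S‖ * ‖T‖ :=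
  (ContinuousLinearMap.opNorm_comp_le _ _).trans
    (mul_le_mul (S.norm_apply_le θ) (T.norm_apply_le θ) (norm_nonneg _) (norm_nonneg _))

/-- Pointwise composition. -/
def OpFam.comp : OpFam H K →L[ℂ] OpFam G H →L[ℂ] OpFam G K :=
  LinearMap.mkContinuous₂
    (LinearMap.mk₂ ℂ
      (fun (S : OpFam H K) (T : OpFam G H) =>
        OpFam.mk (fun θ => S θ ∘L T θ) (‖S‖ * ‖T‖) (OpFam.comp_bound S T))
      (fun S S' T => OpFam.ext fun θ => ContinuousLinearMap.add_comp (S θ) (S' θ) (T θ))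
      (fun c S T => OpFam.ext fun θ => ContinuousLinearMap.smul_comp c (S θ) (T θ))
      (fun S T T' => OpFam.ext fun θ => ContinuousLinearMap.comp_add (S θ) (T θ) (T' θ))
      (fun c S T => OpFam.ext fun θ => ContinuousLinearMap.comp_smul (S θ) c (T θ)))
    1 fun S T => by
      rw [one_mul]
      exact lp.norm_le_of_forall_le (by positivity) (OpFam.comp_bound S T)

@[simp] lemma OpFam.comp_apply (S : OpFam H K) (T : OpFam G H) (θ : Θ) :
    OpFam.comp S T θ = S θ ∘L T θ := rfl

variable [∀ θ, CompleteSpace (H θ)] [∀ θ, CompleteSpace (K θ)]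

/-- Pointwise adjoint. -/
def OpFam.adj : OpFam H K →L⋆[ℂ] OpFam K H :=
  LinearMap.mkContinuous
    { toFun := fun T => OpFam.mk (fun θ => ContinuousLinearMap.adjoint (T θ)) ‖T‖
        fun θ => by simpa using T.norm_apply_le θ
      map_add' := fun S T => OpFam.ext fun θ => map_add ContinuousLinearMap.adjoint (S θ) (T θ)
      map_smul' := fun c T => OpFam.ext fun θ =>
        LinearIsometryEquiv.map_smulₛₗ ContinuousLinearMap.adjoint c (T θ) }
    1 fun T => by
      rw [one_mul]
      exact lp.norm_le_of_forall_le (by positivity) fun θ => by simpa using T.norm_apply_le θ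

@[simp] lemma OpFam.adj_apply (T : OpFam H K) (θ : Θ) :
    OpFam.adj T θ = ContinuousLinearMap.adjoint (T θ) := rfl

lemma OpFam.norm_sq_eq (T : OpFam H K) : ‖T‖ ^ 2 = ‖OpFam.comp (OpFam.adj T) T‖ := by
  refine le_antisymm ?_ ?_
  · rw [← Real.le_sqrt (norm_nonneg _) (norm_nonneg _)]
    refine lp.norm_le_of_forall_le (Real.sqrt_nonneg _) fun θ => ?_
    rw [Real.le_sqrt (norm_nonneg _) (norm_nonneg _), sq,
      ← ContinuousLinearMap.norm_adjoint_comp_self]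
    exact (OpFam.comp (OpFam.adj T) T).norm_apply_le θ
  · refine lp.norm_le_of_forall_le (by positivity) fun θ => ?_
    rw [OpFam.comp_apply, OpFam.adj_apply, ContinuousLinearMap.norm_adjoint_comp_self, ← sq]
    exact pow_le_pow_left₀ (norm_nonneg _) (T.norm_apply_le θ) 2

variable {H : Θ → Type*} [∀ θ, NormedAddCommGroup (H θ)] [∀ θ, InnerProductSpace ℂ (H θ)]
  [∀ θ, CompleteSpace (H θ)]

lemma OpFam.comp_self (S T : OpFam H H) : OpFam.comp S T = S * T := rfl

lemma OpFam.adj_self (T : OpFam H H) : OpFam.adj T = star T := rfl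

end LpOps

/-! ### Restricted tensor products of `C⋆`-algebras -/

section CStar

universe uI u

variable {I : Type uI}

/-- A family of representations `π_v : A_v → 𝔹(H_v)` with vectors `h_v ∈ H_v` such that, for all but
finitely many `v`, `h_v` is a unit vector fixed by the distinguished projection `p_v`. -/
structure RepFamily (A : I → Type u) [∀ v, NonUnitalCStarAlgebra (A v)]
    (p : ∀ v, {q : A v // IsStarProjection q}) where
  /-- The Hilbert spaces. -/
  H : I → Type u
  [instNACG : ∀ v, NormedAddCommGroup (H v)]
  [instIPS : ∀ v, InnerProductSpace ℂ (H v)]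
  [instCS : ∀ v, CompleteSpace (H v)]
  /-- The representations. -/
  π : ∀ v, A v →⋆ₙₐ[ℂ] (H v →L[ℂ] H v)
  /-- The distinguished vectors. -/
  h : ∀ v, H v
  norm_h : ∀ᶠ v in cofinite, ‖h v‖ = 1
  fix_h : ∀ᶠ v in cofinite, π v (p v) (h v) = h v

attribute [instance] RepFamily.instNACG RepFamily.instIPS RepFamily.instCS

/-- The simple tensors `⊗ a_v`, with `a_v = p_v` for all but finitely many `v`. -/
abbrev CStarFamily (A : I → Type u) [∀ v, NonUnitalCStarAlgebra (A v)]
    (p : ∀ v, {q : A v // IsStarProjection q}) : Type _ :=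
  RestrictedFamily A fun v => (p v : A v)

variable {A : I → Type u} [∀ v, NonUnitalCStarAlgebra (A v)]
  {p : ∀ v, {q : A v // IsStarProjection q}}

/-- The Hilbert space `⊗' (H_v, h_v)` of a family of representations. -/
abbrev RepFamily.hilbert (θ : RepFamily A p) : Type _ := HilbertTensor θ.h θ.norm_h

lemma CStarFamily.eventually_fix (θ : RepFamily A p) (a : CStarFamily A p) :
    ∀ᶠ v in cofinite, θ.π v (a v) (θ.h v) = θ.h v := by
  filter_upwards [a.2, θ.fix_h] with v h1 h2
  rw [h1, h2]

/-- The operator `⊗' π_v(a_v)` on `⊗' (H_v, h_v)`. -/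
def RepFamily.op (θ : RepFamily A p) (a : CStarFamily A p) : θ.hilbert →L[ℂ] θ.hilbert :=
  hilbertTensorMap θ.norm_h θ.norm_h (fun v => θ.π v (a v)) (a.eventually_fix θ)

variable (A p) in
/-- The restricted tensor product `⊗' (A_v, p_v)` of `C⋆`-algebras with distinguished projections.
It is realised as the closure of the algebra spanned by the simple tensors `⊗ a_v` in the spatial
norm, in which the norm of an element is the supremum of the norms of the operators by which it
acts on `⊗' (H_v, h_v)`, over all families of representations `(π_v, H_v, h_v)`. -/
def cstarTensor : NonUnitalStarSubalgebra ℂ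
    (OpFam (fun θ : RepFamily A p => θ.hilbert) (fun θ : RepFamily A p => θ.hilbert)) :=
  (NonUnitalStarAlgebra.adjoin ℂ
    {T | ∃ a : CStarFamily A p, ∀ θ : RepFamily A p, T θ = θ.op a}).topologicalClosure

variable (A p) in
/-- The underlying type of the restricted tensor product of `C⋆`-algebras. -/
abbrev CStarTensor : Type _ := cstarTensor A p

lemma isClosed_cstarTensor : IsClosed (cstarTensor A p :
    Set (OpFam (fun θ : RepFamily A p => θ.hilbert) (fun θ : RepFamily A p => θ.hilbert))) :=
  NonUnitalStarSubalgebra.isClosed_topologicalClosure _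

instance : NonUnitalCStarAlgebra (CStarTensor A p) :=
  NonUnitalStarSubalgebra.nonUnitalCStarAlgebra _ (h_closed := isClosed_cstarTensor)

lemma norm_starProjection_le {B : Type*} [NonUnitalCStarAlgebra B]
    (q : {q : B // IsStarProjection q}) : ‖(q : B)‖ ≤ 1 := q.2.norm_le

lemma CStarFamily.eventually_norm_le (a : CStarFamily A p) : ∀ᶠ v in cofinite, ‖a v‖ ≤ 1 := by
  filter_upwards [a.2] with v hv
  rw [hv]
  exact norm_starProjection_le _

lemma RepFamily.norm_π_le (θ : RepFamily A p) (v : I) (a : A v) : ‖θ.π v a‖ ≤ ‖a‖ :=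
  NonUnitalStarAlgHom.norm_apply_le (θ.π v) a

lemma CStarFamily.eventually_opNorm_le (θ : RepFamily A p) (a : CStarFamily A p) :
    ∀ᶠ v in cofinite, ‖θ.π v (a v)‖ ≤ 1 := by
  filter_upwards [a.eventually_norm_le] with v hv
  exact (θ.norm_π_le v _).trans hv

lemma RepFamily.op_norm_le (θ : RepFamily A p) (a : CStarFamily A p) :
    ‖θ.op a‖ ≤ ∏ᶠ v, max 1 ‖a v‖ :=
  hilbertTensorMap_norm_le (fun v => (θ.norm_π_le v _).trans (le_max_right _ _))
    (by filter_upwards [a.eventually_norm_le] with v hv; simp [hv])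

lemma RepFamily.op_tmul (θ : RepFamily A p) (a : CStarFamily A p) (e : RestrictedFamily θ.H θ.h) :
    θ.op a (hilbertTmul θ.norm_h e) =
      hilbertTmul θ.norm_h (e.map (fun v => θ.π v (a v)) (a.eventually_fix θ)) :=
  hilbertTensorMap_tmul (a.eventually_opNorm_le θ) e

/-- The simple tensor `⊗ a_v`, as an element of `⊗' (A_v, p_v)`. -/
def cstarTmul (a : CStarFamily A p) : CStarTensor A p :=
  ⟨OpFam.mk (fun θ => θ.op a) _ (fun θ => θ.op_norm_le a),
    NonUnitalStarSubalgebra.le_topologicalClosure _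
      (NonUnitalStarAlgebra.subset_adjoin ℂ _ ⟨a, fun _ => rfl⟩)⟩

/-- The restricted tensor product `⊗' π_v` of representations of the `A_v`, a representation of
`⊗' (A_v, p_v)` on `⊗' (H_v, h_v)`. -/
def RepFamily.rep (θ : RepFamily A p) :
    CStarTensor A p →⋆ₙₐ[ℂ] (θ.hilbert →L[ℂ] θ.hilbert) where
  toFun a := a.1 θ
  map_smul' _ _ := rfl
  map_zero' := rfl
  map_add' _ _ := rfl
  map_mul' _ _ := rfl
  map_star' _ := rfl

/-- `(⊗' π_v) (⊗ a_v) (⊗ e_v) = ⊗ π_v(a_v) e_v`. -/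
lemma RepFamily.rep_tmul (θ : RepFamily A p) (a : CStarFamily A p)
    (e : RestrictedFamily θ.H θ.h) : θ.rep (cstarTmul a) (hilbertTmul θ.norm_h e) =
      hilbertTmul θ.norm_h (e.map (fun v => θ.π v (a v)) (a.eventually_fix θ)) :=
  θ.op_tmul a e

/-- The norm of `⊗' (A_v, p_v)` is the spatial norm. -/
lemma norm_cstarTensor_le_iff (a : CStarTensor A p) {C : ℝ} (hC : 0 ≤ C) :
    ‖a‖ ≤ C ↔ ∀ θ : RepFamily A p, ‖θ.rep a‖ ≤ C :=
  ⟨fun h θ => (OpFam.norm_apply_le a.1 θ).trans h, fun h => lp.norm_le_of_forall_le hC h⟩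

/-- The family `a_v⋆`. -/
def starFamily (a : CStarFamily A p) : CStarFamily A p :=
  ⟨fun v => star (a v), by
    filter_upwards [a.2] with v h
    rw [h, (p v).2.isSelfAdjoint.star_eq]⟩

lemma RepFamily.op_starFamily (θ : RepFamily A p) (a : CStarFamily A p) :
    θ.op (starFamily a) = ContinuousLinearMap.adjoint (θ.op a) := by
  symm
  have h : (fun v => ContinuousLinearMap.adjoint (θ.π v (a v))) =
      fun v => θ.π v (starFamily a v) := funext fun v => (map_star (θ.π v) (a v)).symm
  rw [RepFamily.op, hilbertTensorMap_adjoint (a.eventually_opNorm_le θ)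
    (hT' := by rw [funext_iff] at h; simp only [h]; exact CStarFamily.eventually_fix θ _)]
  exact hilbertTensorMap_congr h _

lemma star_cstarTmul (a : CStarFamily A p) :
    star (cstarTmul a : CStarTensor A p) = cstarTmul (starFamily a) :=
  Subtype.ext (OpFam.ext fun θ => (θ.op_starFamily a).symm)

/-- The family `a_v b_v`. -/
def mulFamily (a b : CStarFamily A p) : CStarFamily A p :=
  ⟨fun v => a v * b v, by
    filter_upwards [a.2, b.2] with v h1 h2
    rw [h1, h2, (p v).2.isIdempotentElem.eq]⟩

lemma RepFamily.op_mulFamily (θ : RepFamily A p) (a b : CStarFamily A p) :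
    θ.op (mulFamily a b) = θ.op a ∘L θ.op b := by
  symm
  have h : (fun v => θ.π v (a v) ∘L θ.π v (b v)) = fun v => θ.π v (mulFamily a b v) :=
    funext fun v => (map_mul (θ.π v) (a v) (b v)).symm
  rw [RepFamily.op, RepFamily.op, hilbertTensorMap_comp (b.eventually_opNorm_le θ)
    (a.eventually_opNorm_le θ)
    (hRT := by rw [funext_iff] at h; simp only [h]; exact CStarFamily.eventually_fix θ _)]
  exact hilbertTensorMap_congr h _

lemma cstarTmul_mul (a b : CStarFamily A p) :
    (cstarTmul a : CStarTensor A p) * cstarTmul b = cstarTmul (mulFamily a b) :=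
  Subtype.ext (OpFam.ext fun θ => (θ.op_mulFamily a b).symm)

/-- To prove a closed linear condition on all elements of `⊗' (A_v, p_v)` it is enough to prove it
for simple tensors. -/
lemma cstarTensor_induction (V : Submodule ℂ
      (OpFam (fun θ : RepFamily A p => θ.hilbert) (fun θ : RepFamily A p => θ.hilbert)))
    (hV : IsClosed (V : Set (OpFam (fun θ : RepFamily A p => θ.hilbert)
      (fun θ : RepFamily A p => θ.hilbert)))) (h : ∀ a, (cstarTmul a : CStarTensor A p).1 ∈ V)
    (a : CStarTensor A p) : a.1 ∈ V := by
  set s := {T : OpFam (fun θ : RepFamily A p => θ.hilbert) (fun θ : RepFamily A p => θ.hilbert) |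
    ∃ a : CStarFamily A p, ∀ θ : RepFamily A p, T θ = θ.op a} with hs
  have hs1 : ∀ T ∈ s, ∃ a : CStarFamily A p, T = (cstarTmul a : CStarTensor A p).1 := by
    rintro T ⟨a, ha⟩
    exact ⟨a, OpFam.ext ha⟩
  have hs2 : ∀ a : CStarFamily A p, (cstarTmul a : CStarTensor A p).1 ∈ s :=
    fun a => ⟨a, fun _ => rfl⟩
  let N : Subsemigroup (OpFam (fun θ : RepFamily A p => θ.hilbert)
      (fun θ : RepFamily A p => θ.hilbert)) :=
    { carrier := s
      mul_mem' := by
        rintro S T hS hT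
        obtain ⟨a, rfl⟩ := hs1 S hS
        obtain ⟨b, rfl⟩ := hs1 T hT
        have := hs2 (mulFamily a b)
        rw [← cstarTmul_mul] at this
        exact this }
  have h1 : Subsemigroup.closure (s ∪ star s) ≤ N := by
    refine Subsemigroup.closure_le.2 (Set.union_subset subset_rfl fun T hT => ?_)
    obtain ⟨b, hb⟩ := hs1 _ (Set.mem_star.1 hT)
    have h2 := hs2 (starFamily b)
    rw [← star_cstarTmul] at h2
    have h3 : T = (star (cstarTmul b) : CStarTensor A p).1 := by
      rw [← star_star T, hb]
      rfl
    rw [h3]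
    exact h2
  have h2 : (NonUnitalStarAlgebra.adjoin ℂ s : Set (OpFam (fun θ : RepFamily A p => θ.hilbert)
      (fun θ : RepFamily A p => θ.hilbert))) ⊆ V := by
    intro T hT
    have h3 : T ∈ (NonUnitalStarAlgebra.adjoin ℂ s).toSubmodule := hT
    rw [NonUnitalStarAlgebra.adjoin_eq_span] at h3
    refine Submodule.span_le.2 ?_ h3
    intro R hR
    obtain ⟨b, rfl⟩ := hs1 R (h1 hR)
    exact h b
  exact closure_minimal h2 hV a.2

/-- The span of the simple tensors is dense in `⊗' (A_v, p_v)`. -/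
lemma dense_span_cstarTmul :
    (Submodule.span ℂ (Set.range (cstarTmul (A := A) (p := p)))).topologicalClosure = ⊤ := by
  refine eq_top_iff.2 fun y _ => ?_
  have h1 := cstarTensor_induction
    ((Submodule.span ℂ (Set.range (cstarTmul (A := A) (p := p)))).map
      (cstarTensor A p).toSubmodule.subtype).topologicalClosure
    (Submodule.isClosed_topologicalClosure _)
    (fun w => Submodule.le_topologicalClosure _ ⟨_, Submodule.subset_span ⟨w, rfl⟩, rfl⟩) y
  rw [← SetLike.mem_coe, Submodule.topologicalClosure_coe,
    Topology.IsInducing.subtypeVal.closure_eq_preimage_closure_image]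
  exact h1

end CStar


/-! ### Restricted tensor products of Hilbert modules and of correspondences -/

section ModuleTensor

universe uI u

variable {I : Type uI} {A A' : I → Type u} [∀ v, NonUnitalCStarAlgebra (A v)]
  [∀ v, NonUnitalCStarAlgebra (A' v)]
  {p : ∀ v, {q : A v // IsStarProjection q}} {p' : ∀ v, {q : A' v // IsStarProjection q}}
  {X : I → Type u} [∀ v, NormedAddCommGroup (X v)] [∀ v, NormedSpace ℂ (X v)]
  [∀ v, RightHilbertModule (A v) (X v)]

/-- The vectors `x_v` are compatible with the projections `p_v`: for all but finitely many `v`,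
`⟪x_v, x_v⟫ = p_v`. -/
def CompatibleVectors (p : ∀ v, {q : A v // IsStarProjection q}) (x : ∀ v, X v) : Prop :=
  ∀ᶠ v in cofinite, inner (A v) (x v) (x v) = (p v : A v)

variable {x : ∀ v, X v}

open RightHilbertModule

/-- The inner product of two simple tensors, `⟪⊗ w_v, ⊗ z_v⟫ = ⊗ ⟪w_v, z_v⟫`. -/
def innerFamily (hx : CompatibleVectors p x) (w z : RestrictedFamily X x) : CStarFamily A p :=
  ⟨fun v => inner (A v) (w v) (z v), by
    filter_upwards [hx, w.2, z.2] with v h1 h2 h3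
    rw [h2, h3, h1]⟩

lemma norm_le_one_of_compatible (hx : CompatibleVectors p x) :
    ∀ᶠ v in cofinite, ‖x v‖ ≤ 1 := by
  filter_upwards [hx] with v hv
  have h := RightHilbertModule.norm_sq_eq (A := A v) (x v)
  rw [hv] at h
  have := norm_starProjection_le (p v)
  nlinarith [norm_nonneg (x v)]

/-- The simple tensors `x_v ⊗ h_v` are unit vectors for all but finitely many `v`. -/
lemma norm_interior_eventually (hx : CompatibleVectors p x) (θ : RepFamily A p) :
    ∀ᶠ v in cofinite, ‖interiorTmul (θ.π v) (x v) (θ.h v)‖ = 1 := by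
  filter_upwards [hx, θ.norm_h, θ.fix_h] with v h1 h2 h3
  have h := inner_self_eq_norm_sq (𝕜 := ℂ) (interiorTmul (θ.π v) (x v) (θ.h v))
  rw [inner_interiorTmul, h1, h3, inner_self_eq_norm_sq, h2] at h
  nlinarith [norm_nonneg (interiorTmul (θ.π v) (x v) (θ.h v))]

/-- The Hilbert space `⊗' (X_v ⊗_{A_v} H_v, x_v ⊗ h_v)`. -/
abbrev RepFamily.target (θ : RepFamily A p) (hx : CompatibleVectors p x) : Type _ :=
  HilbertTensor (fun v => interiorTmul (θ.π v) (x v) (θ.h v)) (norm_interior_eventually hx θ)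

lemma eventually_creation (θ : RepFamily A p) (w : RestrictedFamily X x) :
    ∀ᶠ v in cofinite, creation (θ.π v) (w v) (θ.h v) = interiorTmul (θ.π v) (x v) (θ.h v) := by
  filter_upwards [w.2] with v h1
  rw [h1, creation_apply]

lemma RestrictedFamily.eventually_norm_le (hx : CompatibleVectors p x)
    (w : RestrictedFamily X x) : ∀ᶠ v in cofinite, ‖w v‖ ≤ 1 := by
  filter_upwards [w.2, norm_le_one_of_compatible hx] with v h1 h2
  rwa [h1]

/-- The creation operator `⊗ e_v ↦ ⊗ (w_v ⊗ e_v)` of the simple tensor `⊗ w_v`. -/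
def RepFamily.creationOp (θ : RepFamily A p) (hx : CompatibleVectors p x)
    (w : RestrictedFamily X x) : θ.hilbert →L[ℂ] θ.target hx :=
  hilbertTensorMap θ.norm_h (norm_interior_eventually hx θ) (fun v => creation (θ.π v) (w v))
    (eventually_creation θ w)

lemma eventually_norm_creation_le (θ : RepFamily A p) (hx : CompatibleVectors p x)
    (w : RestrictedFamily X x) : ∀ᶠ v in cofinite, ‖creation (θ.π v) (w v)‖ ≤ 1 := by
  filter_upwards [w.eventually_norm_le hx] with v hv
  exact (norm_creation_le _ _).trans hv

lemma RepFamily.creationOp_norm_le (θ : RepFamily A p) (hx : CompatibleVectors p x)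
    (w : RestrictedFamily X x) : ‖θ.creationOp hx w‖ ≤ ∏ᶠ v, max 1 ‖w v‖ :=
  hilbertTensorMap_norm_le (fun v => (norm_creation_le _ _).trans (le_max_right _ _))
    (by filter_upwards [w.eventually_norm_le hx] with v hv; simp [hv])

lemma RepFamily.creationOp_tmul (θ : RepFamily A p) (hx : CompatibleVectors p x)
    (w : RestrictedFamily X x) (e : RestrictedFamily θ.H θ.h) :
    θ.creationOp hx w (hilbertTmul θ.norm_h e) = hilbertTmul (norm_interior_eventually hx θ)
      (e.map (fun v => creation (θ.π v) (w v)) (eventually_creation θ w)) :=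
  hilbertTensorMap_tmul (eventually_norm_creation_le θ hx w) e

lemma RepFamily.adjoint_creationOp_comp (θ : RepFamily A p) (hx : CompatibleVectors p x)
    (w z : RestrictedFamily X x) :
    ContinuousLinearMap.adjoint (θ.creationOp hx w) ∘L θ.creationOp hx z =
      θ.op (innerFamily hx w z) := by
  have h1 : ∀ᶠ v in cofinite, ContinuousLinearMap.adjoint (creation (θ.π v) (w v))
      (interiorTmul (θ.π v) (x v) (θ.h v)) = θ.h v := by
    filter_upwards [w.2, hx, θ.fix_h] with v h1 h2 h3
    rw [creation_adjoint_tmul, h1, h2, h3]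
  have h2 : (fun v => ContinuousLinearMap.adjoint (creation (θ.π v) (w v)) ∘L
      creation (θ.π v) (z v)) = fun v => θ.π v (innerFamily hx w z v) :=
    funext fun v => creation_adjoint_comp _ _ _
  rw [RepFamily.creationOp, RepFamily.creationOp, hilbertTensorMap_adjoint
    (eventually_norm_creation_le θ hx w) (hT' := h1), hilbertTensorMap_comp
    (hRT := by rw [funext_iff] at h2; simp only [h2]; exact CStarFamily.eventually_fix θ _)
    (eventually_norm_creation_le θ hx z)]
  · exact hilbertTensorMap_congr h2 _
  · filter_upwards [eventually_norm_creation_le θ hx w] with v hv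
    simpa using hv

/-- The restricted tensor product `⊗' (X_v, x_v)` of a compatible collection of Hilbert modules. It
is the completion of the span of the simple tensors `⊗ w_v`, with `w_v = x_v` for all but finitely
many `v`, in the norm of the inner product `⟪⊗ w_v, ⊗ z_v⟫ = ⊗ ⟪w_v, z_v⟫` with values in
`⊗' (A_v, p_v)`. It is realised by identifying `⊗ w_v` with its creation operators
`⊗' (H_v, h_v) → ⊗' (X_v ⊗ H_v, x_v ⊗ h_v)`, for all families of representations
`(π_v, H_v, h_v)`. -/
def moduleTensor (hx : CompatibleVectors p x) : Submodule ℂ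
    (OpFam (fun θ : RepFamily A p => θ.hilbert) (fun θ : RepFamily A p => θ.target hx)) :=
  (Submodule.span ℂ {T | ∃ w : RestrictedFamily X x, ∀ θ : RepFamily A p,
    T θ = θ.creationOp hx w}).topologicalClosure

/-- The underlying type of the restricted tensor product of Hilbert modules. -/
abbrev ModuleTensor (hx : CompatibleVectors p x) : Type _ := moduleTensor hx

instance (hx : CompatibleVectors p x) : CompleteSpace (ModuleTensor hx) :=
  (Submodule.isClosed_topologicalClosure _).completeSpace_coe

/-- The simple tensor `⊗ w_v`, as an element of `⊗' (X_v, x_v)`. -/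
def moduleTmul (hx : CompatibleVectors p x) (w : RestrictedFamily X x) : ModuleTensor hx :=
  ⟨OpFam.mk (fun θ => θ.creationOp hx w) _ (fun θ => θ.creationOp_norm_le hx w),
    Submodule.le_topologicalClosure _ (Submodule.subset_span ⟨w, fun _ => rfl⟩)⟩

lemma moduleTensor_induction (hx : CompatibleVectors p x) (P : Submodule ℂ
      (OpFam (fun θ : RepFamily A p => θ.hilbert) (fun θ : RepFamily A p => θ.target hx)))
    (hP : IsClosed (P : Set (OpFam (fun θ : RepFamily A p => θ.hilbert)
      (fun θ : RepFamily A p => θ.target hx)))) (h : ∀ w, (moduleTmul hx w).1 ∈ P)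
    (y : ModuleTensor hx) : y.1 ∈ P := by
  refine Submodule.topologicalClosure_minimal _ (Submodule.span_le.2 ?_) hP y.2
  rintro T ⟨w, hw⟩
  have : T = (moduleTmul hx w).1 := OpFam.ext hw
  rw [this]
  exact h w

/-- The span of the simple tensors is dense in `⊗' (X_v, x_v)`. -/
lemma dense_span_moduleTmul (hx : CompatibleVectors p x) :
    (Submodule.span ℂ (Set.range (moduleTmul hx))).topologicalClosure = ⊤ := by
  refine eq_top_iff.2 fun y _ => ?_
  have h1 := moduleTensor_induction hx
    ((Submodule.span ℂ (Set.range (moduleTmul hx))).map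
      (moduleTensor hx).subtype).topologicalClosure (Submodule.isClosed_topologicalClosure _)
    (fun w => Submodule.le_topologicalClosure _ ⟨_, Submodule.subset_span ⟨w, rfl⟩, rfl⟩) y
  rw [← SetLike.mem_coe, Submodule.topologicalClosure_coe,
    Topology.IsInducing.subtypeVal.closure_eq_preimage_closure_image]
  exact h1


/-- The values `⟪S, T⟫ = S⋆ T` of the inner product lie in `⊗' (A_v, p_v)`. -/
lemma adj_comp_mem (hx : CompatibleVectors p x) (S T : ModuleTensor hx) :
    OpFam.comp (OpFam.adj S.1) T.1 ∈ cstarTensor A p := by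
  let V : Submodule ℂ (OpFam (fun θ : RepFamily A p => θ.hilbert)
      (fun θ : RepFamily A p => θ.hilbert)) := (cstarTensor A p).toSubmodule
  have hV : IsClosed (V : Set (OpFam (fun θ : RepFamily A p => θ.hilbert)
      (fun θ : RepFamily A p => θ.hilbert))) := isClosed_cstarTensor
  have h1 : ∀ (w z : RestrictedFamily X x),
      OpFam.comp (OpFam.adj (moduleTmul hx w).1) (moduleTmul hx z).1 ∈ V := by
    intro w z
    have : OpFam.comp (OpFam.adj (moduleTmul hx w).1) (moduleTmul hx z).1 =
        (cstarTmul (innerFamily hx w z)).1 :=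
      OpFam.ext fun θ => θ.adjoint_creationOp_comp hx w z
    rw [this]
    exact (cstarTmul (innerFamily hx w z)).2
  have h2 : ∀ (w : RestrictedFamily X x) (T : ModuleTensor hx),
      OpFam.comp (OpFam.adj (moduleTmul hx w).1) T.1 ∈ V := by
    intro w T
    let L : OpFam (fun θ : RepFamily A p => θ.hilbert) (fun θ : RepFamily A p => θ.target hx) →L[ℂ]
        OpFam (fun θ : RepFamily A p => θ.hilbert) (fun θ : RepFamily A p => θ.hilbert) :=
      OpFam.comp (OpFam.adj (moduleTmul hx w).1)
    exact moduleTensor_induction hx (V.comap L.toLinearMap) (hV.preimage L.continuous) (h1 w) T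
  let L : OpFam (fun θ : RepFamily A p => θ.target hx) (fun θ : RepFamily A p => θ.hilbert) →L[ℂ]
      OpFam (fun θ : RepFamily A p => θ.hilbert) (fun θ : RepFamily A p => θ.hilbert) :=
    OpFam.comp.flip T.1
  let M : OpFam (fun θ : RepFamily A p => θ.hilbert) (fun θ : RepFamily A p => θ.target hx) →L⋆[ℂ]
      OpFam (fun θ : RepFamily A p => θ.hilbert) (fun θ : RepFamily A p => θ.hilbert) :=
    L.comp OpFam.adj
  exact moduleTensor_induction hx (V.comap M.toLinearMap) (hV.preimage M.continuous)
    (fun w => h2 w T) S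

lemma act_eventually (hx : CompatibleVectors p x) :
    ∀ᶠ v in cofinite, act (x v) (p v : A v) = x v := by
  filter_upwards [hx] with v hv
  have h1 := (p v).2.isIdempotentElem
  have h2 := (p v).2.isSelfAdjoint.star_eq
  have h3 : ‖act (x v) (p v : A v) - x v‖ ^ 2 = 0 := by
    rw [norm_sq_eq (A := A v)]
    simp only [RightHilbertModule.inner_sub_right, RightHilbertModule.inner_sub_left, inner_act_right,
      inner_act_left, hv, h2, h1.eq]
    simp
  rw [← sub_eq_zero, ← norm_eq_zero]
  exact (pow_eq_zero_iff two_ne_zero).1 h3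

/-- The family `w_v a_v`. -/
def actFamily (hx : CompatibleVectors p x) (w : RestrictedFamily X x) (a : CStarFamily A p) :
    RestrictedFamily X x :=
  ⟨fun v => act (w v) (a v), by
    filter_upwards [act_eventually hx, w.2, a.2] with v h1 h2 h3
    rw [h2, h3, h1]⟩

lemma RepFamily.creationOp_comp_op (θ : RepFamily A p) (hx : CompatibleVectors p x)
    (w : RestrictedFamily X x) (a : CStarFamily A p) :
    θ.creationOp hx w ∘L θ.op a = θ.creationOp hx (actFamily hx w a) := by
  have h : (fun v => creation (θ.π v) (w v) ∘L θ.π v (a v)) =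
      fun v => creation (θ.π v) (actFamily hx w a v) :=
    funext fun v => ContinuousLinearMap.ext fun k => (act_interiorTmul _ _ _ _).symm
  rw [RepFamily.creationOp, RepFamily.op, hilbertTensorMap_comp (a.eventually_opNorm_le θ)
    (eventually_norm_creation_le θ hx w)
    (hRT := by rw [funext_iff] at h; simp only [h]; exact eventually_creation θ _)]
  exact hilbertTensorMap_congr h _

lemma comp_mem (hx : CompatibleVectors p x) (T : ModuleTensor hx) (a : CStarTensor A p) :
    OpFam.comp T.1 a.1 ∈ moduleTensor hx := by
  have hV : IsClosed (moduleTensor hx : Set (OpFam (fun θ : RepFamily A p => θ.hilbert)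
    (fun θ : RepFamily A p => θ.target hx))) := Submodule.isClosed_topologicalClosure _
  have key : ∀ (a : CStarFamily A p) (T : ModuleTensor hx),
      OpFam.comp T.1 (cstarTmul a).1 ∈ moduleTensor hx := by
    intro a T
    let L : OpFam (fun θ : RepFamily A p => θ.hilbert) (fun θ : RepFamily A p => θ.target hx) →L[ℂ]
        OpFam (fun θ : RepFamily A p => θ.hilbert) (fun θ : RepFamily A p => θ.target hx) :=
      OpFam.comp.flip (cstarTmul a).1
    refine moduleTensor_induction hx ((moduleTensor hx).comap L.toLinearMap)
      (hV.preimage L.continuous) (fun w => ?_) T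
    have : OpFam.comp (moduleTmul hx w).1 (cstarTmul a).1 = (moduleTmul hx (actFamily hx w a)).1 :=
      OpFam.ext fun θ => θ.creationOp_comp_op hx w a
    change OpFam.comp (moduleTmul hx w).1 (cstarTmul a).1 ∈ moduleTensor hx
    rw [this]
    exact (moduleTmul hx (actFamily hx w a)).2
  let L : OpFam (fun θ : RepFamily A p => θ.hilbert) (fun θ : RepFamily A p => θ.hilbert) →L[ℂ]
      OpFam (fun θ : RepFamily A p => θ.hilbert) (fun θ : RepFamily A p => θ.target hx) :=
    OpFam.comp T.1
  exact cstarTensor_induction ((moduleTensor hx).comap L.toLinearMap)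
    (hV.preimage L.continuous) (fun a => key a T) a

lemma exists_adj_comp_eq (hx : CompatibleVectors p x) (S : ModuleTensor hx) :
    ∃ a : CStarTensor A p, (⟨_, adj_comp_mem hx S S⟩ : CStarTensor A p) = star a * a := by
  set M : CStarTensor A p := ⟨_, adj_comp_mem hx S S⟩ with hM
  have hMθ : ∀ θ, M.1 θ = ContinuousLinearMap.adjoint (S.1 θ) ∘L S.1 θ := fun θ => rfl
  have hMs : IsSelfAdjoint M := Subtype.ext <| OpFam.ext fun θ => by
    change ContinuousLinearMap.adjoint (ContinuousLinearMap.adjoint (S.1 θ) ∘L S.1 θ) = _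
    rw [ContinuousLinearMap.adjoint_comp, ContinuousLinearMap.adjoint_adjoint]
    rfl
  obtain ⟨N, r, hNs, hr, hMN, hN⟩ := exists_negPart M hMs
  refine hN ?_
  have h1 : star N * M * N + star (r * N) * (r * N) = 0 := by
    rw [mul_assoc, hMN, star_mul, mul_assoc (star N), ← mul_assoc (star r), ← hr]
    simp
  have h2 : r * N = 0 := Subtype.ext <| OpFam.ext fun θ => ContinuousLinearMap.ext fun ξ => by
    have h3 : inner ℂ ξ ((star N * M * N + star (r * N) * (r * N)).1 θ ξ) = 0 := by
      rw [h1]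
      exact inner_zero_right _
    have h4 : inner ℂ ξ ((star N * M * N + star (r * N) * (r * N)).1 θ ξ) =
        inner ℂ (S.1 θ (N.1 θ ξ)) (S.1 θ (N.1 θ ξ)) +
          inner ℂ ((r * N).1 θ ξ) ((r * N).1 θ ξ) := by
      change inner ℂ ξ (ContinuousLinearMap.adjoint (N.1 θ) (ContinuousLinearMap.adjoint (S.1 θ)
          (S.1 θ (N.1 θ ξ))) + ContinuousLinearMap.adjoint ((r * N).1 θ) ((r * N).1 θ ξ)) = _
      rw [_root_.inner_add_right, ContinuousLinearMap.adjoint_inner_right,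
        ContinuousLinearMap.adjoint_inner_right, ContinuousLinearMap.adjoint_inner_right]
    rw [h4] at h3
    have h5 := congr(RCLike.re $h3)
    rw [map_add, inner_self_eq_norm_sq, inner_self_eq_norm_sq, map_zero] at h5
    have h6 := ((add_eq_zero_iff_of_nonneg (sq_nonneg _) (sq_nonneg _)).1 h5).2
    exact norm_eq_zero.1 ((pow_eq_zero_iff two_ne_zero).1 h6)
  have h4 : star N * N = 0 := by
    rw [hNs.star_eq]
    conv_lhs => enter [1]; rw [hr]
    rw [mul_assoc, h2, mul_zero]
  exact (CStarRing.star_mul_self_eq_zero_iff _).1 h4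

/-- `⊗' (X_v, x_v)` is a Hilbert module over `⊗' (A_v, p_v)`, with `⟪S, T⟫ = S⋆ T` and the right
action by composition. -/
instance (hx : CompatibleVectors p x) :
    RightHilbertModule (CStarTensor A p) (ModuleTensor hx) where
  inner S T := ⟨_, adj_comp_mem hx S T⟩
  act T a := ⟨_, comp_mem hx T a⟩
  add_act S T a := Subtype.ext <| OpFam.ext fun θ =>
    ContinuousLinearMap.add_comp (S.1 θ) (T.1 θ) (a.1 θ)
  act_add T a b := Subtype.ext <| OpFam.ext fun θ =>
    ContinuousLinearMap.comp_add (T.1 θ) (a.1 θ) (b.1 θ)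
  act_mul T a b := Subtype.ext <| OpFam.ext fun θ => rfl
  smul_act c T a := Subtype.ext <| OpFam.ext fun θ =>
    ContinuousLinearMap.smul_comp c (T.1 θ) (a.1 θ)
  act_smul c T a := Subtype.ext <| OpFam.ext fun θ =>
    ContinuousLinearMap.comp_smul (T.1 θ) c (a.1 θ)
  inner_add_right S T R := Subtype.ext <| OpFam.ext fun θ =>
    ContinuousLinearMap.comp_add (ContinuousLinearMap.adjoint (S.1 θ)) (T.1 θ) (R.1 θ)
  inner_smul_right c S T := Subtype.ext <| OpFam.ext fun θ =>
    ContinuousLinearMap.comp_smul (ContinuousLinearMap.adjoint (S.1 θ)) c (T.1 θ)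
  inner_act_right S T a := Subtype.ext <| OpFam.ext fun θ => rfl
  star_inner S T := Subtype.ext <| OpFam.ext fun θ => by
    change ContinuousLinearMap.adjoint (ContinuousLinearMap.adjoint (S.1 θ) ∘L T.1 θ) = _
    rw [ContinuousLinearMap.adjoint_comp, ContinuousLinearMap.adjoint_adjoint]
    rfl
  inner_self_nonneg S := exists_adj_comp_eq hx S
  norm_sq_eq S := OpFam.norm_sq_eq S.1

/-- `⟪⊗ w_v, ⊗ z_v⟫ = ⊗ ⟪w_v, z_v⟫`. -/
lemma inner_moduleTmul (hx : CompatibleVectors p x) (w z : RestrictedFamily X x) :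
    inner (CStarTensor A p) (moduleTmul hx w) (moduleTmul hx z) =
      cstarTmul (innerFamily hx w z) :=
  Subtype.ext (OpFam.ext fun θ => θ.adjoint_creationOp_comp hx w z)

/-- `(⊗ w_v) (⊗ a_v) = ⊗ w_v a_v`. -/
lemma act_moduleTmul (hx : CompatibleVectors p x) (w : RestrictedFamily X x)
    (a : CStarFamily A p) :
    act (moduleTmul hx w) (cstarTmul a) = moduleTmul hx (actFamily hx w a) :=
  Subtype.ext (OpFam.ext fun θ => θ.creationOp_comp_op hx w a)

/-- The families `(α_v)` are compatible with the vectors `x_v`: for all but finitely many `v`,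
`α_v(p'_v) x_v = x_v`. -/
def CompatibleCorrespondences (p' : ∀ v, {q : A' v // IsStarProjection q}) (x : ∀ v, X v)
    (α : ∀ v, Correspondence (A' v) (A v) (X v)) : Prop :=
  ∀ᶠ v in cofinite, α v (p' v) (x v) = x v

variable {α : ∀ v, Correspondence (A' v) (A v) (X v)}

/-- The representations `α_v ⊗ 1` of `A'_v` on `X_v ⊗ H_v` induced from representations of the
`A_v`, with the vectors `x_v ⊗ h_v`. -/
def RepFamily.push (θ : RepFamily A p) (hx : CompatibleVectors p x)
    (hα : CompatibleCorrespondences p' x α) : RepFamily A' p' where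
  H v := InteriorTensor (X v) (θ.π v)
  π v := (α v).induce (θ.π v)
  h v := interiorTmul (θ.π v) (x v) (θ.h v)
  norm_h := norm_interior_eventually hx θ
  fix_h := by
    filter_upwards [hα] with v hv
    rw [Correspondence.induce_tmul, hv]

/-- The family `α_v(a_v) w_v`. -/
def leftFamily (hα : CompatibleCorrespondences p' x α) (a : CStarFamily A' p')
    (w : RestrictedFamily X x) : RestrictedFamily X x :=
  ⟨fun v => α v (a v) (w v), by
    filter_upwards [hα, w.2, a.2] with v h1 h2 h3
    rw [h2, h3, h1]⟩

/-- The operator of `a ∈ ⊗' (A'_v, p'_v)` on `⊗' (X_v ⊗ H_v, x_v ⊗ h_v)`. -/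
def RepFamily.pushOp (θ : RepFamily A p) (hx : CompatibleVectors p x)
    (hα : CompatibleCorrespondences p' x α) (a : CStarTensor A' p') :
    θ.target hx →L[ℂ] θ.target hx :=
  a.1 (θ.push hx hα)

lemma RepFamily.pushOp_comp_creationOp (θ : RepFamily A p) (hx : CompatibleVectors p x)
    (hα : CompatibleCorrespondences p' x α) (a : CStarFamily A' p') (w : RestrictedFamily X x) :
    θ.pushOp hx hα (cstarTmul a) ∘L θ.creationOp hx w = θ.creationOp hx (leftFamily hα a w) := by
  refine hilbert_ext fun e => ?_
  rw [ContinuousLinearMap.comp_apply, RepFamily.creationOp_tmul, RepFamily.creationOp_tmul]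
  refine ((θ.push hx hα).op_tmul a _).trans ?_
  have : ∀ (e e' : RestrictedFamily (fun v => InteriorTensor (X v) (θ.π v))
      (fun v => interiorTmul (θ.π v) (x v) (θ.h v))), (∀ v, e v = e' v) →
      hilbertTmul (norm_interior_eventually hx θ) e =
        hilbertTmul (norm_interior_eventually hx θ) e' := by
    intro e e' h
    rw [Subtype.ext (funext h)]
  exact this _ _ fun v => (α v).induce_tmul (θ.π v) (a v) (w v) (e v)

/-- The operators of `a ∈ ⊗' (A'_v, p'_v)` on all the spaces `⊗' (X_v ⊗ H_v, x_v ⊗ h_v)`. -/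
def pushFam (hx : CompatibleVectors p x) (hα : CompatibleCorrespondences p' x α) :
    CStarTensor A' p' →L[ℂ]
      OpFam (fun θ : RepFamily A p => θ.target hx) (fun θ : RepFamily A p => θ.target hx) :=
  LinearMap.mkContinuous
    { toFun := fun a => OpFam.mk (fun θ => θ.pushOp hx hα a) ‖a.1‖
        fun θ => OpFam.norm_apply_le a.1 (θ.push hx hα)
      map_add' := fun _ _ => OpFam.ext fun _ => rfl
      map_smul' := fun _ _ => OpFam.ext fun _ => rfl }
    1 fun a => by
      rw [one_mul]
      exact lp.norm_le_of_forall_le (norm_nonneg _)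
        fun θ => OpFam.norm_apply_le a.1 (θ.push hx hα)

lemma pushFam_apply (hx : CompatibleVectors p x) (hα : CompatibleCorrespondences p' x α)
    (a : CStarTensor A' p') (θ : RepFamily A p) : pushFam hx hα a θ = θ.pushOp hx hα a := rfl

lemma pushFam_comp_mem (hx : CompatibleVectors p x) (hα : CompatibleCorrespondences p' x α)
    (a : CStarTensor A' p') (T : ModuleTensor hx) :
    OpFam.comp (pushFam hx hα a) T.1 ∈ moduleTensor hx := by
  have hV : IsClosed (moduleTensor hx : Set (OpFam (fun θ : RepFamily A p => θ.hilbert)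
    (fun θ : RepFamily A p => θ.target hx))) := Submodule.isClosed_topologicalClosure _
  have key : ∀ (a : CStarFamily A' p') (T : ModuleTensor hx),
      OpFam.comp (pushFam hx hα (cstarTmul a)) T.1 ∈ moduleTensor hx := by
    intro a T
    let L : OpFam (fun θ : RepFamily A p => θ.hilbert) (fun θ : RepFamily A p => θ.target hx) →L[ℂ]
        OpFam (fun θ : RepFamily A p => θ.hilbert) (fun θ : RepFamily A p => θ.target hx) :=
      OpFam.comp (pushFam hx hα (cstarTmul a))
    refine moduleTensor_induction hx ((moduleTensor hx).comap L.toLinearMap)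
      (hV.preimage L.continuous) (fun w => ?_) T
    have : OpFam.comp (pushFam hx hα (cstarTmul a)) (moduleTmul hx w).1 =
        (moduleTmul hx (leftFamily hα a w)).1 :=
      OpFam.ext fun θ => θ.pushOp_comp_creationOp hx hα a w
    change OpFam.comp (pushFam hx hα (cstarTmul a)) (moduleTmul hx w).1 ∈ moduleTensor hx
    rw [this]
    exact (moduleTmul hx (leftFamily hα a w)).2
  let L : OpFam (fun θ : RepFamily A p => θ.target hx) (fun θ : RepFamily A p => θ.target hx) →L[ℂ]
      OpFam (fun θ : RepFamily A p => θ.hilbert) (fun θ : RepFamily A p => θ.target hx) :=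
    OpFam.comp.flip T.1
  have hL : ∀ a : CStarTensor A' p', a ∈ (Submodule.span ℂ
      (Set.range (cstarTmul (A := A') (p := p')))).topologicalClosure := fun a => by
    rw [dense_span_cstarTmul]; trivial
  have hW : IsClosed (((moduleTensor hx).comap (L ∘L pushFam hx hα).toLinearMap :
      Submodule ℂ (CStarTensor A' p')) : Set (CStarTensor A' p')) :=
    hV.preimage (L ∘L pushFam hx hα).continuous
  refine Submodule.topologicalClosure_minimal _ (Submodule.span_le.2 ?_) hW (hL a)
  rintro _ ⟨b, rfl⟩
  exact key b T

/-- The restricted tensor product `⊗' (X_v, x_v)` of correspondences: the `⋆`-homomorphism from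
`⊗' (A'_v, p'_v)` to the adjointable operators on `⊗' (X_v, x_v)` determined by
`α(⊗ a_v) (⊗ w_v) = ⊗ α_v(a_v) w_v`. -/
def tensorCorrespondence (hx : CompatibleVectors p x) (hα : CompatibleCorrespondences p' x α) :
    Correspondence (CStarTensor A' p') (CStarTensor A p) (ModuleTensor hx) where
  toAlgHom :=
    { toFun := fun a => LinearMap.mkContinuous
        { toFun := fun T => ⟨_, pushFam_comp_mem hx hα a T⟩
          map_add' := fun S T => Subtype.ext (map_add (OpFam.comp (pushFam hx hα a)) S.1 T.1)
          map_smul' := fun c T => Subtype.ext (map_smul (OpFam.comp (pushFam hx hα a)) c T.1) }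
        ‖OpFam.comp (G := fun θ : RepFamily A p => θ.hilbert) (pushFam hx hα a)‖
        fun T => (OpFam.comp (pushFam hx hα a)).le_opNorm T.1
      map_smul' := fun c a => ContinuousLinearMap.ext fun T => Subtype.ext <| OpFam.ext fun θ => rfl
      map_zero' := ContinuousLinearMap.ext fun T => Subtype.ext <| OpFam.ext fun θ => rfl
      map_add' := fun a b => ContinuousLinearMap.ext fun T => Subtype.ext <| OpFam.ext fun θ => rfl
      map_mul' := fun a b => ContinuousLinearMap.ext fun T => Subtype.ext <|
        OpFam.ext fun θ => rfl }
  adjoint a S T := Subtype.ext <| OpFam.ext fun θ => by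
    change ContinuousLinearMap.adjoint (θ.pushOp hx hα a ∘L S.1 θ) ∘L T.1 θ =
      ContinuousLinearMap.adjoint (S.1 θ) ∘L
        (ContinuousLinearMap.adjoint (θ.pushOp hx hα a) ∘L T.1 θ)
    rw [ContinuousLinearMap.adjoint_comp, ContinuousLinearMap.comp_assoc]

/-- `α(⊗ a_v) (⊗ w_v) = ⊗ α_v(a_v) w_v`. -/
lemma tensorCorrespondence_tmul (hx : CompatibleVectors p x)
    (hα : CompatibleCorrespondences p' x α) (a : CStarFamily A' p') (w : RestrictedFamily X x) :
    tensorCorrespondence hx hα (cstarTmul a) (moduleTmul hx w) =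
      moduleTmul hx (leftFamily hα a w) :=
  Subtype.ext (OpFam.ext fun θ => θ.pushOp_comp_creationOp hx hα a w)

/-- The collection of correspondences is coherent: for all but finitely many `v`, `α_v(p'_v)` is the
rank one projection `z ↦ x_v ⟪x_v, z⟫`. -/
def IsCoherent (p' : ∀ v, {q : A' v // IsStarProjection q}) (x : ∀ v, X v)
    (α : ∀ v, Correspondence (A' v) (A v) (X v)) : Prop :=
  ∀ᶠ v in cofinite, α v (p' v) = rankOne (A v) (x v) (x v)

/-- The collection of correspondences is type I: it is coherent, and the image of each `α_v`
contains the `A_v`-compact operators on `X_v`. -/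
def IsTypeICollection (p' : ∀ v, {q : A' v // IsStarProjection q}) (x : ∀ v, X v)
    (α : ∀ v, Correspondence (A' v) (A v) (X v)) : Prop :=
  IsCoherent p' x α ∧ ∀ v, ∀ T ∈ compactOperators (A v) (X v), ∃ a : A' v, α v a = T

end ModuleTensor

/-! ### Type I representations -/

section Representations

variable {B H K : Type*} [NonUnitalCStarAlgebra B] [NormedAddCommGroup H] [InnerProductSpace ℂ H]
  [CompleteSpace H] [NormedAddCommGroup K] [InnerProductSpace ℂ K] [CompleteSpace K]

/-- Unitary equivalence of representations. -/
def UnitarilyEquivalent (π : B →⋆ₙₐ[ℂ] (H →L[ℂ] H)) (ρ : B →⋆ₙₐ[ℂ] (K →L[ℂ] K)) : Prop :=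
  ∃ U : H ≃ₗᵢ[ℂ] K, ∀ b ξ, U (π b ξ) = ρ b (U ξ)

/-- A representation is irreducible if the only closed invariant subspaces are `0` and the whole
space. -/
def IsIrreducibleRep (π : B →⋆ₙₐ[ℂ] (H →L[ℂ] H)) : Prop :=
  ∀ W : Submodule ℂ H, IsClosed (W : Set H) → (∀ b, ∀ ξ ∈ W, π b ξ ∈ W) → W = ⊥ ∨ W = ⊤

/-- An irreducible representation is type I if its image contains the compact operators. -/
def IsTypeI (π : B →⋆ₙₐ[ℂ] (H →L[ℂ] H)) : Prop :=
  IsIrreducibleRep π ∧ ∀ T : H →L[ℂ] H, IsCompactOperator T → ∃ b : B, π b = T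

end Representations

end AdelicTensor

end

universe u

/-! Unitary equivalence. An element `T` of the restricted tensor product `X` of the modules is a
family of operators indexed by the families of representations, so it has a component `T_θ` from `⊗'
H_v` to `⊗' (X_v ⊗ H_v)` at the given `θ`. Let `U` be the unitary from `H` to `⊗' H_v`. The
assignment `T ⊗ ξ ↦ T_θ (U ξ)` preserves inner products, because `⟪S, T⟫ = S⋆ T` acts through
`θ.rep` as `S_θ⋆ T_θ`. Its values are total, because they include the tensors `⊗ (w_v ⊗ e_v)`, and
these span a dense subspace by `hilbertTmul_mem_of_total`. It therefore extends to a unitary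
(`exists_kernelSpace_isometryEquiv`), which intertwines the two actions since the left action on `X`
is composition with the operators of `θ.push`.

Type I. Write `C_y` for the creation operator `ξ ↦ y ⊗ ξ`. If `α(b)` is the module operator `u ↦ (y
a) ⟪z, u⟫`, then `(α ⊗ 1)(b) = C_y π(a) C_z⋆`. For simple tensors `y`, `z`, `a` such a `b` exists:
the local type I condition supplies its components, and coherence allows all but finitely many of
them to be `p'_v` (`exists_tensorCorrespondence_eq_rankOne`). The image of a `⋆`-homomorphism of
`C⋆`-algebras is closed (`isClosed_starHomRange`), so `C_y π(a) C_z⋆` lies in the image of `α ⊗ 1`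
for every `a`. If `π(a)` is the rank one operator `ξ ⟨η, ·⟩`, this is the rank one operator `(y ⊗ ξ)
⟨z ⊗ η, ·⟩`. Simple tensors being total, closedness gives first all rank one operators and then all
compact ones; a representation whose image contains the rank one operators is irreducible. -/

namespace AdelicTensor

/-! ### Images of `⋆`-homomorphisms of `C⋆`-algebras are closed -/

section ClosedRange

variable {A B : Type*} [NonUnitalCStarAlgebra A] [NonUnitalCStarAlgebra B]

lemma continuous_starHom (φ : A →⋆ₙₐ[ℂ] B) : Continuous φ :=
  AddMonoidHomClass.continuous_of_bound φ 1 fun a => by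
    simpa using NonUnitalStarAlgHom.norm_apply_le φ a

/-- A self-adjoint element of the image of a `⋆`-homomorphism lifts to an element of no larger
norm. -/
lemma exists_lift_of_isSelfAdjoint (φ : A →⋆ₙₐ[ℂ] B) {a : A} (ha : IsSelfAdjoint a) :
    ∃ a' : A, φ a' = φ a ∧ ‖a'‖ ≤ ‖φ a‖ := by
  set r : ℝ := ‖φ a‖
  have hr : 0 ≤ r := norm_nonneg _
  -- The lift is obtained by truncating `a` to `[-r, r]` with the functional calculus. Truncation
  -- bounds the norm by `r`, and it does not change `φ a`, whose spectrum already lies in this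
  -- interval. The value `f 0 = 0` is what the non-unital calculus requires.
  let f : ℝ → ℝ := fun t => max (-r) (min r t)
  have hf : Continuous f := by fun_prop
  have hf0 : f 0 = 0 := by simp [f, hr]
  have hφa : IsSelfAdjoint (φ a) := ha.map φ
  have hφc := continuous_starHom φ
  refine ⟨cfcₙ f a, ?_, norm_cfcₙ_le fun t _ => ?_⟩
  · rw [NonUnitalStarAlgHomClass.map_cfcₙ φ f a hf.continuousOn hf0 hφc ha hφa]
    conv_rhs => rw [← cfcₙ_id' ℝ (φ a)]
    refine cfcₙ_congr fun t ht => ?_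
    -- Applied to the identity function, this says that a point of the quasispectrum of `φ a` has
    -- absolute value at most `‖φ a‖ = r`.
    have h1 := norm_apply_le_norm_cfcₙ (fun t : ℝ => t) (φ a) ht
    rw [cfcₙ_id' ℝ (φ a), Real.norm_eq_abs, abs_le] at h1
    simp only [f]
    rw [min_eq_right h1.2, max_eq_right h1.1]
  · rw [Real.norm_eq_abs, abs_le]
    exact ⟨le_max_left _ _, max_le (by linarith) (min_le_left _ _)⟩

/-- A closed subspace which contains the images of a total subset under a `⋆`-homomorphism contains
its whole image. -/
lemma starHom_apply_mem (φ : A →⋆ₙₐ[ℂ] B) {s : Set A}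
    (hs : (Submodule.span ℂ s).topologicalClosure = ⊤) {V : Submodule ℂ B}
    (hV : IsClosed (V : Set B)) (h : ∀ a ∈ s, φ a ∈ V) (a : A) : φ a ∈ V := by
  have : (⊤ : Submodule ℂ A) ≤ V.comap (φ : A →ₗ[ℂ] B) := by
    rw [← hs]
    exact Submodule.topologicalClosure_minimal _ (Submodule.span_le.2 h)
      (hV.preimage (continuous_starHom φ))
  exact this trivial

/-- An element of the image of a `⋆`-homomorphism lifts with control of the norm. -/
lemma exists_lift_norm_le (φ : A →⋆ₙₐ[ℂ] B) (a : A) :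
    ∃ a' : A, φ a' = φ a ∧ ‖a'‖ ≤ 2 * ‖φ a‖ := by
  -- The real and imaginary parts are lifted separately, each with norm at most `‖φ a‖`; their sum
  -- accounts for the factor 2.
  obtain ⟨b, hb, hb'⟩ := exists_lift_of_isSelfAdjoint φ (realPart a).2
  obtain ⟨c, hc, hc'⟩ := exists_lift_of_isSelfAdjoint φ (imaginaryPart a).2
  -- Real and imaginary parts are formed with a real scalar, whereas `φ` is linear over `ℂ`;
  -- continuity lets `map_real_smul` move the real scalar through.
  have hφ := continuous_starHom φ
  have e1 : φ (realPart a : A) = (realPart (φ a) : B) := by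
    simp only [realPart_apply_coe, map_real_smul φ hφ, map_add, map_star]
  have e2 : φ (imaginaryPart a : A) = (imaginaryPart (φ a) : B) := by
    simp only [imaginaryPart_apply_coe, map_smul, map_real_smul φ hφ, map_sub, map_star]
  refine ⟨b + Complex.I • c, ?_, ?_⟩
  · rw [map_add, map_smul, hb, hc, e1, e2, realPart_add_I_smul_imaginaryPart]
  · rw [e1] at hb'
    rw [e2] at hc'
    calc _ ≤ ‖b‖ + ‖Complex.I • c‖ := norm_add_le _ _
      _ = ‖b‖ + ‖c‖ := by rw [norm_smul]; simp
      _ ≤ ‖φ a‖ + ‖φ a‖ := add_le_add (hb'.trans (realPart.norm_le (φ a)))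
          (hc'.trans (imaginaryPart.norm_le (φ a)))
      _ = _ := by ring

/-- The image of a `⋆`-homomorphism, as a subspace. -/
def starHomRange (φ : A →⋆ₙₐ[ℂ] B) : Submodule ℂ B := LinearMap.range (φ : A →ₗ[ℂ] B)

/-- The image of a `⋆`-homomorphism of `C⋆`-algebras is closed. -/
lemma isClosed_starHomRange (φ : A →⋆ₙₐ[ℂ] B) : IsClosed (starHomRange φ : Set B) := by
  let f : NormedAddGroupHom A B :=
    { toFun := φ, map_add' := map_add φ,
      bound' := ⟨1, fun a => by simpa using NonUnitalStarAlgHom.norm_apply_le φ a⟩ }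
  have h : f.SurjectiveOnWith f.range 2 := by
    rintro _ ⟨a, rfl⟩
    -- Bounded lifting turns a convergent series in the image into a convergent series in `A`, so
    -- completeness of `A` gives a preimage for every limit point. Any positive slack in the
    -- resulting bound would do; here it is 1.
    exact exists_lift_norm_le φ a
  have h2 := controlled_closure_of_complete two_pos one_pos h
  refine isClosed_of_closure_subset fun b hb => ?_
  obtain ⟨a, ha, -⟩ := h2 b hb
  exact ⟨a, ha⟩

end ClosedRange

/-! ### Compact operators and a rank one criterion for type I -/

section Compact

variable {H : Type*} [NormedAddCommGroup H] [InnerProductSpace ℂ H] [CompleteSpace H]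

/-- A closed subspace of operators which contains the rank one operators contains the compact
operators. -/
lemma mem_of_isCompactOperator (J : Submodule ℂ (H →L[ℂ] H)) (hJ : IsClosed (J : Set (H →L[ℂ] H)))
    (h1 : ∀ u v : H, InnerProductSpace.rankOne ℂ u v ∈ J) {T : H →L[ℂ] H}
    (hT : IsCompactOperator T) : T ∈ J := by
  have hcl : closure (J : Set (H →L[ℂ] H)) = J := hJ.closure_eq
  rw [← SetLike.mem_coe, ← hcl, Metric.mem_closure_iff]
  intro ε hε
  have hK := hT.isCompact_closure_image_closedBall 1
  -- `T` is approximated by `P T`, with `P` the orthogonal projection onto the span of a finite net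
  -- for the image of the unit ball. The radius is `ε / 2` because the operator norm estimate is not
  -- strict, while the distance has to be strictly below `ε`.
  obtain ⟨t, ht, htK⟩ := Metric.totallyBounded_iff.1 hK.totallyBounded (ε / 2) (half_pos hε)
  have : Finite t := ht
  let V : Submodule ℂ H := Submodule.span ℂ t
  have : FiniteDimensional ℂ V := FiniteDimensional.span_of_finite ℂ ht
  let b := stdOrthonormalBasis ℂ V
  let P : H →L[ℂ] H := V.starProjection
  refine ⟨P ∘L T, ?_, ?_⟩
  -- Expanding `P` in an orthonormal basis `b` of the span gives `P T ξ = ∑ b_i ⟨b_i, T ξ⟩ = ∑ b_i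
  -- ⟨T⋆ b_i, ξ⟩`, a finite sum of rank one operators.
  · have : P ∘L T = ∑ i, InnerProductSpace.rankOne ℂ (b i : H)
        (ContinuousLinearMap.adjoint T (b i : H)) := by
      ext ξ
      simp only [P, b.starProjection_eq_sum_rankOne, ContinuousLinearMap.comp_apply, sum_apply,
        InnerProductSpace.rankOne_apply, ContinuousLinearMap.adjoint_inner_left]
    rw [this]
    exact J.sum_mem fun i _ => h1 _ _
  · rw [dist_eq_norm]
    refine lt_of_le_of_lt (ContinuousLinearMap.opNorm_le_of_unit_norm (half_pos hε).le
      fun ξ hξ => ?_) (half_lt_self hε)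
    have h2 : T ξ ∈ ⋃ y ∈ t, Metric.ball y (ε / 2) :=
      htK (subset_closure ⟨ξ, by simp [hξ], rfl⟩)
    simp only [Set.mem_iUnion, Metric.mem_ball, exists_prop] at h2
    obtain ⟨y, hy, hyd⟩ := h2
    rw [dist_eq_norm] at hyd
    refine le_trans ?_ hyd.le
    -- `P` realises the distance to the span, so the error is at most the distance from `T ξ` to the
    -- nearby net point `y`.
    have := V.starProjection_minimal (T ξ)
    change ‖T ξ - V.starProjection (T ξ)‖ ≤ _
    rw [this]
    exact ciInf_le ⟨0, by rintro _ ⟨z, rfl⟩; exact norm_nonneg _⟩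
      (⟨y, Submodule.subset_span hy⟩ : V)

variable {B : Type*} [NonUnitalCStarAlgebra B]

/-- A representation whose image contains the rank one operators is type I. -/
lemma isTypeI_of_rankOne_mem (ρ : B →⋆ₙₐ[ℂ] (H →L[ℂ] H))
    (h : ∀ u v : H, ∃ b, ρ b = InnerProductSpace.rankOne ℂ u v) : IsTypeI ρ := by
  refine ⟨fun W _ hW => ?_, fun T hT => ?_⟩
  · refine or_iff_not_imp_left.2 fun h0 => ?_
    obtain ⟨w, hw, hw0⟩ := W.exists_mem_ne_zero_of_ne_bot h0
    refine eq_top_iff.2 fun u _ => ?_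
    -- The operator `u ⟨w, ·⟩` sends `w` to a non-zero multiple of `u`, so an invariant subspace
    -- containing some `w ≠ 0` contains every `u`.
    obtain ⟨b, hb⟩ := h u w
    have h2 := hW b w hw
    rw [hb, InnerProductSpace.rankOne_apply] at h2
    exact (W.smul_mem_iff (inner_self_ne_zero.2 hw0)).1 h2
  · exact mem_of_isCompactOperator (starHomRange ρ) (isClosed_starHomRange ρ) h hT

/-- It suffices to find the rank one operators of the vectors of a total subset. -/
lemma isTypeI_of_rankOne_mem_of_total (ρ : B →⋆ₙₐ[ℂ] (H →L[ℂ] H)) {D : Set H}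
    (hD : (Submodule.span ℂ D).topologicalClosure = ⊤)
    (h : ∀ u ∈ D, ∀ v ∈ D, ∃ b, ρ b = InnerProductSpace.rankOne ℂ u v) : IsTypeI ρ := by
  have hJ := isClosed_starHomRange ρ
  have h2 : ∀ u, ∀ v ∈ D, InnerProductSpace.rankOne ℂ u v ∈ starHomRange ρ := by
    intro u v hv
    -- Totality is used in one variable at a time: first `u` becomes arbitrary with `v` in `D`, then
    -- `v` becomes arbitrary as well. Each time the preimage of the closed image is a closed
    -- subspace containing `D`.
    let L := (InnerProductSpace.rankOne ℂ (E := H)).flip v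
    have : (⊤ : Submodule ℂ H) ≤ (starHomRange ρ).comap L.toLinearMap := by
      rw [← hD]
      exact Submodule.topologicalClosure_minimal _ (Submodule.span_le.2 fun u hu => h u hu v hv)
        (hJ.preimage L.continuous)
    exact this (trivial : u ∈ ⊤)
  refine isTypeI_of_rankOne_mem ρ fun u v => ?_
  -- In this variable the dependence is conjugate-linear, and preimages of subspaces are still
  -- subspaces.
  let L := InnerProductSpace.rankOne ℂ (F := H) u
  have : (⊤ : Submodule ℂ H) ≤ (starHomRange ρ).comap L.toLinearMap := by
    rw [← hD]
    exact Submodule.topologicalClosure_minimal _ (Submodule.span_le.2 fun v hv => h2 u v hv)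
      (hJ.preimage L.continuous)
  exact this (trivial : v ∈ ⊤)

end Compact

/-! ### Recognising a Hilbert space from the Gram matrix of a total family -/

section KernelUnitary

variable {S : Type*} {K : Matrix S S ℂ} {hK : K.PosSemidef}

lemma dense_span_kernelVec :
    (Submodule.span ℂ (Set.range (kernelVec K hK))).topologicalClosure = ⊤ := by
  refine eq_top_iff.2 fun u _ => ?_
  rw [← Finsupp.range_linearCombination]
  have : kernelLin K hK = Finsupp.linearCombination ℂ (kernelVec K hK) :=
    LinearMap.ext (kernelLin_eq K hK)
  rw [← this]
  exact denseRange_kernelLin K hK u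

/-- A Hilbert space with a total family of vectors is the one generated by their inner products. -/
lemma exists_kernelSpace_isometryEquiv {E : Type*} [NormedAddCommGroup E] [InnerProductSpace ℂ E]
    [CompleteSpace E] (F : S → E) (hF : ∀ s t, inner ℂ (F s) (F t) = K s t)
    (hd : (Submodule.span ℂ (Set.range F)).topologicalClosure = ⊤) :
    ∃ U : KernelSpace K hK ≃ₗᵢ[ℂ] E, ∀ s, U (kernelVec K hK s) = F s := by
  have hKF : K = Matrix.gram ℂ F := by ext s t; exact (hF s t).symm
  -- Both squared norms are the value of the same form, since `K` is the Gram matrix of `F`. This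
  -- gives both that the lift is well defined and that it is isometric.
  have hn : ∀ f : S →₀ ℂ, ‖Finsupp.linearCombination ℂ F f‖ = ‖kernelLin K hK f‖ := fun f => by
    rw [← sq_eq_sq₀ (norm_nonneg _) (norm_nonneg _), ← inner_self_eq_norm_sq (𝕜 := ℂ),
      ← inner_self_eq_norm_sq (𝕜 := ℂ), inner_kernelLin, ← kernelForm_gram, hKF]
  have hb : ∀ f : S →₀ ℂ, ‖Finsupp.linearCombination ℂ F f‖ ≤ 1 * ‖kernelLin K hK f‖ :=
    fun f => by rw [one_mul, hn]
  let L : KernelSpace K hK →L[ℂ] E := kernelLift K hK F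
  have hL : ∀ s, L (kernelVec K hK s) = F s := kernelLift_apply hb
  have hiso : ∀ u, ‖L u‖ = ‖u‖ := fun u => by
    refine (denseRange_kernelLin K hK).induction_on u
      (isClosed_eq (L.continuous.norm) continuous_norm) fun f => ?_
    rw [← hn, kernelLin_eq, Finsupp.linearCombination_apply, Finsupp.linearCombination_apply,
      Finsupp.sum, map_sum]
    simp [hL, Finsupp.sum]
  let L' : KernelSpace K hK →ₗᵢ[ℂ] E := ⟨L.toLinearMap, hiso⟩
  have hsurj : Function.Surjective L' := by
    -- The range of an isometry from a complete space is closed; containing the total family `F`, it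
    -- is everything.
    have hcl : IsClosed (LinearMap.range L'.toLinearMap : Set E) :=
      L'.isometry.isClosedEmbedding.isClosed_range
    have : (⊤ : Submodule ℂ E) ≤ LinearMap.range L'.toLinearMap := by
      rw [← hd]
      refine Submodule.topologicalClosure_minimal _ (Submodule.span_le.2 ?_) hcl
      rintro _ ⟨s, rfl⟩
      exact ⟨_, hL s⟩
    exact fun y => this trivial
  exact ⟨LinearIsometryEquiv.ofSurjective L' hsurj, hL⟩

end KernelUnitary

/-! ### Simple tensors as functions of one component -/

section Coordinates

variable {I : Type*}

open Classical in
/-- Replacing the component of a restricted family at one index. -/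
noncomputable def RestrictedFamily.update {W : I → Type*} {x : ∀ v, W v}
    (e : RestrictedFamily W x) (a : I) (k : W a) : RestrictedFamily W x :=
  ⟨Function.update e.1 a k, by
    filter_upwards [e.2, (Set.finite_singleton a).compl_mem_cofinite] with v h1 h2
    rw [Function.update_of_ne (by simpa using h2), h1]⟩

lemma RestrictedFamily.update_self {W : I → Type*} {x : ∀ v, W v} (e : RestrictedFamily W x)
    (a : I) (k : W a) : e.update a k a = k := by
  classical exact Function.update_self (f := e.1) ..

lemma RestrictedFamily.update_of_ne {W : I → Type*} {x : ∀ v, W v} (e : RestrictedFamily W x)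
    {a v : I} (h : v ≠ a) (k : W a) : e.update a k v = e v := by
  classical exact Function.update_of_ne h k e.1

lemma RestrictedFamily.update_eq_self {W : I → Type*} {x : ∀ v, W v} (e : RestrictedFamily W x)
    (a : I) : e.update a (e a) = e := by
  classical exact Subtype.ext (Function.update_eq_self a e.1)

variable {H : I → Type*} [∀ v, NormedAddCommGroup (H v)] [∀ v, InnerProductSpace ℂ (H v)]
  {h : ∀ v, H v} (hn : ∀ᶠ v in cofinite, ‖h v‖ = 1)

open Classical in
-- Pulling the factor at `a` out of the infinite product leaves a factor independent of `k`, which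
-- makes the linearity and the boundedness in `k` visible. The value 1 at `a` in the remaining
-- product stands for the removed factor.
lemma inner_update_update (s e : RestrictedFamily H h) (a : I) (k : H a) :
    inner ℂ (hilbertTmul hn s) (hilbertTmul hn (e.update a k)) =
      inner ℂ (s a) k * ∏ᶠ v, if v = a then 1 else inner ℂ (s v) (e v) := by
  have h1 : ∀ v, inner ℂ (s v) (e.update a k v) =
      (if v = a then inner ℂ (s a) k else 1) * (if v = a then 1 else inner ℂ (s v) (e v)) := by
    intro v
    by_cases hv : v = a
    · subst hv
      simp [e.update_self]
    · simp [hv, e.update_of_ne hv]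
  -- A `finprod` with infinite multiplicative support is 1 by default, so splitting it needs both
  -- supports finite: the first lies in `{a}`, the second in the finite set where `⟨s_v, e_v⟩ ≠ 1`.
  rw [inner_hilbertTmul, finprod_congr h1, finprod_mul_distrib, finprod_eq_single _ a]
  · simp
  · intro v hv
    simp [hv]
  · refine (Set.finite_singleton a).subset fun v hv => ?_
    by_contra h2
    exact hv (by simp_all)
  · refine (Filter.eventually_cofinite.1 (inner_eventually_one hn s e)).subset fun v hv => ?_
    intro h2
    exact hv (by simp [h2])

/-- A simple tensor, as a function of one of its components. -/
lemma exists_hilbertTmul_update_eq (e : RestrictedFamily H h) (a : I) :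
    ∃ L : H a →L[ℂ] HilbertTensor h hn, ∀ k, L k = hilbertTmul hn (e.update a k) := by
  classical
  -- This is the contribution of the components other than `a` to the squared norm: the squared norm
  -- of the updated tensor is `⟨k, k⟩ c`, hence the bound `√‖c‖ ‖k‖`.
  set c : ℂ := ∏ᶠ v, if v = a then 1 else inner ℂ (e v) (e v)
  let L : H a →ₗ[ℂ] HilbertTensor h hn :=
    { toFun := fun k => hilbertTmul hn (e.update a k)
      -- Linearity is tested on inner products with simple tensors, where it can be read off from
      -- `inner_update_update`.
      map_add' := fun k l => kernelVec_ext fun s => by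
        rw [_root_.inner_add_right]
        simp only [← hilbertTmul.eq_1 hn s, inner_update_update, _root_.inner_add_right, add_mul]
      map_smul' := fun z k => kernelVec_ext fun s => by
        rw [RingHom.id_apply, _root_.inner_smul_right]
        simp only [← hilbertTmul.eq_1 hn s, inner_update_update, _root_.inner_smul_right,
          mul_assoc] }
  refine ⟨L.mkContinuous √‖c‖ fun k => ?_, fun k => rfl⟩
  refine le_of_sq_le_sq ?_ (by positivity)
  change ‖hilbertTmul hn (e.update a k)‖ ^ 2 ≤ _
  rw [mul_pow, Real.sq_sqrt (norm_nonneg _), ← inner_self_eq_norm_sq (𝕜 := ℂ),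
    inner_update_update, e.update_self]
  have : (∏ᶠ v, if v = a then 1 else inner ℂ (e.update a k v) (e v)) = c :=
    finprod_congr fun v => by
      by_cases hv : v = a
      · simp [hv]
      · simp [hv, e.update_of_ne hv]
  rw [this]
  refine (RCLike.re_le_norm _).trans ?_
  rw [norm_mul, mul_comm, sq ‖k‖]
  gcongr
  exact norm_inner_le_norm k k

/-- A closed subspace of a restricted tensor product contains all simple tensors as soon as it
contains those whose components lie in given total subsets. -/
lemma hilbertTmul_mem_of_total {D : ∀ v, Set (H v)}
    (hD : ∀ v, (Submodule.span ℂ (D v)).topologicalClosure = ⊤) (hh : ∀ᶠ v in cofinite, h v ∈ D v)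
    {V : Submodule ℂ (HilbertTensor h hn)} (hV : IsClosed (V : Set (HilbertTensor h hn)))
    (h0 : ∀ e : RestrictedFamily H h, (∀ v, e v ∈ D v) → hilbertTmul hn e ∈ V)
    (e : RestrictedFamily H h) : hilbertTmul hn e ∈ V := by
  classical
  -- The induction is on a finite set of indices at which the component may lie outside `D v`. One
  -- component at a time is freed: the vectors allowed at `a` form a closed subspace containing the
  -- total set `D a`.
  have key : ∀ (F : Finset I) (e : RestrictedFamily H h), (∀ v ∉ F, e v ∈ D v) →
      hilbertTmul hn e ∈ V := by
    intro F
    induction F using Finset.induction_on with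
    | empty => exact fun e he => h0 e fun v => he v (by simp)
    | insert a F ha ih =>
      intro e he
      obtain ⟨L, hL⟩ := exists_hilbertTmul_update_eq hn e a
      have h1 : (⊤ : Submodule ℂ (H a)) ≤ V.comap L.toLinearMap := by
        rw [← hD a]
        refine Submodule.topologicalClosure_minimal _ (Submodule.span_le.2 fun k hk => ?_)
          (hV.preimage L.continuous)
        change L k ∈ V
        rw [hL]
        refine ih _ fun v hv => ?_
        by_cases hva : v = a
        · subst hva
          rwa [e.update_self]
        · rw [e.update_of_ne hva]
          exact he v (by simp [hva, hv])
      have h2 : L (e a) ∈ V := h1 trivial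
      rwa [hL, e.update_eq_self] at h2
  -- Since almost every component of `e` is `h v`, which almost always lies in `D v`, a finite set
  -- of exceptional indices suffices.
  have hfin : ∀ᶠ v in cofinite, e v ∈ D v := by
    filter_upwards [e.2, hh] with v h1 h2
    rwa [h1]
  exact key (Filter.eventually_cofinite.1 hfin).toFinset e fun v hv => by simpa using hv

end Coordinates

/-! ### Rank one module operators and the induced representation -/

section Interior

open RightHilbertModule

variable {A A' X H : Type*} [NonUnitalCStarAlgebra A] [NonUnitalCStarAlgebra A']
  [NormedAddCommGroup X] [NormedSpace ℂ X]
  [RightHilbertModule A X] [NormedAddCommGroup H] [InnerProductSpace ℂ H] [CompleteSpace H]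
  (π : A →⋆ₙₐ[ℂ] (H →L[ℂ] H))

lemma creation_act (y : X) (a : A) : creation π (act y a) = creation π y ∘L π a :=
  ContinuousLinearMap.ext fun k => act_interiorTmul π y a k

/-- Where `α(b)` is a rank one operator of the module, `(α ⊗ 1)(b)` factors through `H`. -/
lemma Correspondence.induce_of_eq_rankOne (α : Correspondence A' A X) {b : A'} {y z : X}
    (hb : α b = rankOne A y z) :
    α.induce π b = creation π y ∘L ContinuousLinearMap.adjoint (creation π z) := by
  refine interior_ext π fun u k => ?_
  rw [α.induce_tmul, hb, rankOne_apply, act_interiorTmul, ContinuousLinearMap.comp_apply,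
    creation_adjoint_tmul, creation_apply]

/-- The simple tensor `y ⊗ k`, as a function of `y`. -/
noncomputable def rightCreation (X : Type*) [NormedAddCommGroup X] [NormedSpace ℂ X]
    [RightHilbertModule A X] (k : H) : X →L[ℂ] InteriorTensor X π :=
  LinearMap.mkContinuous
    { toFun := fun y => interiorTmul π y k
      map_add' := fun y z => add_interiorTmul π y z k
      map_smul' := fun c y => smul_interiorTmul π c y k } ‖k‖ fun y =>
    (norm_interiorTmul_le π y k).trans_eq (mul_comm _ _)

variable {π}

/-- If `α(A')` contains the rank one operators `u ↦ y a ⟪z, u⟫`, with `a` in a total subset of `A`,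
then `(α ⊗ 1)(A')` contains the operators of `A` conjugated by creation operators. -/
lemma Correspondence.exists_induce_eq_creation_comp (α : Correspondence A' A X) {s : Set A}
    (hs : (Submodule.span ℂ s).topologicalClosure = ⊤) {y z : X}
    (h : ∀ a ∈ s, ∃ b, α b = rankOne A (act y a) z) (a : A) :
    ∃ b, α.induce π b =
      creation π y ∘L π a ∘L ContinuousLinearMap.adjoint (creation π z) := by
  -- `L` is `R ↦ C_y R C_z⋆`, with `C_y` the creation operator of `y`. It is continuous and the
  -- image of `α ⊗ 1` is closed, so the operators `R` that it sends into this image form a closed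
  -- subspace, and it suffices to treat `π(a)` for `a ∈ s`.
  let L : (H →L[ℂ] H) →L[ℂ] (InteriorTensor X π →L[ℂ] InteriorTensor X π) :=
    ContinuousLinearMap.compL ℂ _ _ _ (creation π y) ∘L
      (ContinuousLinearMap.compL ℂ _ _ _).flip (ContinuousLinearMap.adjoint (creation π z))
  refine starHom_apply_mem π hs (V := (starHomRange (α.induce π)).comap L.toLinearMap)
    ((isClosed_starHomRange (α.induce π)).preimage L.continuous) (fun e he => ?_) a
  obtain ⟨b, hb⟩ := h e he
  refine ⟨b, (α.induce_of_eq_rankOne π hb).trans ?_⟩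
  -- For `a ∈ s` the element `b` gives `C_{y a} C_z⋆`, which is `C_y π(a) C_z⋆` because the tensor
  -- product is balanced over `A`.
  rw [creation_act]
  rfl

/-- For fixed `ξ` the map `y ↦ y ⊗ ξ` is bounded and linear, so it carries the total set `D` into a
set whose closed span contains all `y ⊗ ξ`. Only the module variable is restricted: in the
application `D` consists of the simple tensors of the module, while `ξ` may be any vector of `H`. -/
lemma dense_span_interiorTmul {D : Set X} (hD : (Submodule.span ℂ D).topologicalClosure = ⊤) :
    (Submodule.span ℂ {u : InteriorTensor X π | ∃ y ∈ D, ∃ ξ, u = interiorTmul π y ξ}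
      ).topologicalClosure = ⊤ := by
  set E := {u : InteriorTensor X π | ∃ y ∈ D, ∃ ξ, u = interiorTmul π y ξ}
  refine eq_top_iff.2 ((dense_span_kernelVec (hK := interiorKernel_posSemidef π)).ge.trans ?_)
  refine Submodule.topologicalClosure_minimal _ (Submodule.span_le.2 ?_)
    (Submodule.isClosed_topologicalClosure _)
  rintro _ ⟨⟨y, ξ⟩, rfl⟩
  have : (⊤ : Submodule ℂ X) ≤
      (Submodule.span ℂ E).topologicalClosure.comap (rightCreation π X ξ).toLinearMap := by
    rw [← hD]
    refine Submodule.topologicalClosure_minimal _ (Submodule.span_le.2 fun y hy => ?_)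
      ((Submodule.isClosed_topologicalClosure _).preimage (rightCreation π X ξ).continuous)
    exact Submodule.le_topologicalClosure _ (Submodule.subset_span ⟨y, hy, ξ, rfl⟩)
  exact this (trivial : y ∈ ⊤)

/-- If `α(A')` contains sufficiently many rank one operators of the module `X`, then `X` carries
type I representations of `A` to type I representations of `A'`. -/
lemma Correspondence.isTypeI_induce (α : Correspondence A' A X) {D : Set X}
    (hD : (Submodule.span ℂ D).topologicalClosure = ⊤) {s : Set A}
    (hs : (Submodule.span ℂ s).topologicalClosure = ⊤)
    (h : ∀ y ∈ D, ∀ z ∈ D, ∀ a ∈ s, ∃ b, α b = rankOne A (act y a) z) (hπ : IsTypeI π) :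
    IsTypeI (α.induce π) := by
  set E := {u : InteriorTensor X π | ∃ y ∈ D, ∃ ξ, u = interiorTmul π y ξ}
  have hE : (Submodule.span ℂ E).topologicalClosure = ⊤ := dense_span_interiorTmul hD
  refine isTypeI_of_rankOne_mem_of_total _ hE ?_
  rintro _ ⟨y, hy, ξ, rfl⟩ _ ⟨z, hz, η, rfl⟩
  -- The operator `ξ ⟨η, ·⟩` factors through the locally compact space `ℂ`. Being compact, it is
  -- `π(a)` for some `a`.
  have hcpt : IsCompactOperator (InnerProductSpace.rankOne ℂ ξ η) :=
    IsCompactOperator.clm_comp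
      (isCompactOperator_of_locallyCompactSpace_dom (innerSL ℂ η))
      (ContinuousLinearMap.toSpanSingleton ℂ ξ)
  obtain ⟨a, ha⟩ := hπ.2 _ hcpt
  obtain ⟨b, hb⟩ := α.exists_induce_eq_creation_comp (π := π) hs (h y hy z hz) a
  refine ⟨b, hb.trans ?_⟩
  rw [ha]
  refine ContinuousLinearMap.ext fun u => ?_
  -- The identity behind this is `C_y (ξ ⟨η, ·⟩) C_z⋆ = (C_y ξ) ⟨C_z η, ·⟩`, the rank one operator
  -- of `y ⊗ ξ` and `z ⊗ η`.
  simp only [ContinuousLinearMap.comp_apply, InnerProductSpace.rankOne_apply, map_smul,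
    ContinuousLinearMap.adjoint_inner_right, creation_apply]

end Interior

/-! ### Induction along the restricted tensor product of correspondences -/

section Induced

universe uI uA

variable {I : Type uI} {A A' : I → Type uA} [∀ v, NonUnitalCStarAlgebra (A v)]
  [∀ v, NonUnitalCStarAlgebra (A' v)]
  {p : ∀ v, {q : A v // IsStarProjection q}} {p' : ∀ v, {q : A' v // IsStarProjection q}}
  {X : I → Type uA} [∀ v, NormedAddCommGroup (X v)] [∀ v, NormedSpace ℂ (X v)]
  [∀ v, RightHilbertModule (A v) (X v)] {x : ∀ v, X v}
  {α : ∀ v, Correspondence (A' v) (A v) (X v)}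
  {H : Type*} [NormedAddCommGroup H] [InnerProductSpace ℂ H] [CompleteSpace H]

open RightHilbertModule

/-- This regroups `⊗ (w_v ⊗ e_v)` as the creation operator of `⊗ w_v` applied to `⊗ e_v`. It is what
makes the comparison map from `X ⊗_A H` surjective. -/
lemma RepFamily.exists_creationOp_eq (θ : RepFamily A p) (hx : CompatibleVectors p x)
    (f : RestrictedFamily (fun v => InteriorTensor (X v) (θ.π v))
      (fun v => interiorTmul (θ.π v) (x v) (θ.h v)))
    (hf : ∀ v, f v ∈ Set.range (kernelVec _ (interiorKernel_posSemidef (X := X v) (θ.π v)))) :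
    ∃ (w : RestrictedFamily X x) (e : RestrictedFamily θ.H θ.h),
      hilbertTmul (norm_interior_eventually hx θ) f =
        θ.creationOp hx w (hilbertTmul θ.norm_h e) := by
  -- A vector may be a simple tensor in many ways. Insisting on the pair `(x v, θ.h v)` wherever `f
  -- v` is the distinguished vector ensures that the chosen components form restricted families.
  have h1 : ∀ v, ∃ s : X v × θ.H v, interiorTmul (θ.π v) s.1 s.2 = f v ∧
      (f v = interiorTmul (θ.π v) (x v) (θ.h v) → s = (x v, θ.h v)) := by
    intro v
    by_cases hv : f v = interiorTmul (θ.π v) (x v) (θ.h v)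
    · exact ⟨(x v, θ.h v), hv.symm, fun _ => rfl⟩
    · obtain ⟨s, hs⟩ := hf v
      exact ⟨s, hs, fun h => absurd h hv⟩
  choose s hs hs' using h1
  refine ⟨⟨fun v => (s v).1, f.2.mono fun v hv => by simp only [hs' v hv]⟩,
    ⟨fun v => (s v).2, f.2.mono fun v hv => by simp only [hs' v hv]⟩, ?_⟩
  refine Eq.trans ?_ (θ.creationOp_tmul hx _ _).symm
  exact congrArg _ (Subtype.ext (funext fun v => (hs v).symm))

/-- If `π` is the restricted tensor product of the `π_v`, then `α ⊗ 1` is the restricted tensor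
product of the `α_v ⊗ 1`. -/
lemma unitarilyEquivalent_induce (hx : CompatibleVectors p x)
    (hα : CompatibleCorrespondences p' x α) {π : CStarTensor A p →⋆ₙₐ[ℂ] (H →L[ℂ] H)}
    {θ : RepFamily A p} (hθ : UnitarilyEquivalent π θ.rep) :
    UnitarilyEquivalent ((tensorCorrespondence hx hα).induce π) (θ.push hx hα).rep := by
  obtain ⟨U, hU⟩ := hθ
  -- Elements of the tensor product module are families of operators over all families of
  -- representations; the comparison map evaluates the component at the given `θ`.
  let F : ModuleTensor hx × H → θ.target hx := fun s => s.1.1 θ (U s.2)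
  have hF : ∀ s t, inner ℂ (F s) (F t) = interiorKernel (ModuleTensor hx) π s t := by
    intro s t
    -- The inner product of the module is `S⋆ T` and `θ.rep` is evaluation at `θ`, so moving one
    -- operator across the inner product produces `θ.rep` of the module inner product.
    have h1 : inner ℂ (F s) (F t) =
        inner ℂ (U s.2) (θ.rep (inner (CStarTensor A p) s.1 t.1) (U t.2)) :=
      (ContinuousLinearMap.adjoint_inner_right (s.1.1 θ) (U s.2) (F t)).symm
    rw [h1, ← hU, U.inner_map_map]
    rfl
  have hd : (Submodule.span ℂ (Set.range F)).topologicalClosure = ⊤ := by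
    refine eq_top_iff.2 ((dense_span_kernelVec (K := tensorKernel _)
      (hK := tensorKernel_posSemidef (norm_interior_eventually hx θ))).ge.trans ?_)
    refine Submodule.topologicalClosure_minimal _ (Submodule.span_le.2 ?_)
      (Submodule.isClosed_topologicalClosure _)
    rintro _ ⟨f, rfl⟩
    -- It is enough to reach the tensors all of whose components are simple tensors `w_v ⊗ e_v`; the
    -- distinguished vectors are of this form at every `v`.
    refine hilbertTmul_mem_of_total (norm_interior_eventually hx θ)
      (fun v => dense_span_kernelVec) (.of_forall fun v => ⟨(x v, θ.h v), rfl⟩)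
      (Submodule.isClosed_topologicalClosure _) (fun f hf => ?_) f
    obtain ⟨w, e, h1⟩ := θ.exists_creationOp_eq hx f hf
    refine Submodule.le_topologicalClosure _ (Submodule.subset_span
      ⟨(moduleTmul hx w, U.symm (hilbertTmul θ.norm_h e)), ?_⟩)
    rw [h1]
    change θ.creationOp hx w (U (U.symm _)) = _
    rw [U.apply_symm_apply]
  obtain ⟨V, hV⟩ := exists_kernelSpace_isometryEquiv (hK := interiorKernel_posSemidef π) F hF hd
  refine ⟨V, fun b => ?_⟩
  have : (V.toContinuousLinearEquiv : InteriorTensor (ModuleTensor hx) π →L[ℂ] θ.target hx) ∘L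
      (tensorCorrespondence hx hα).induce π b = (θ.push hx hα).rep b ∘L
      (V.toContinuousLinearEquiv : InteriorTensor (ModuleTensor hx) π →L[ℂ] θ.target hx) := by
    refine interior_ext π fun T ξ => ?_
    change V ((tensorCorrespondence hx hα).induce π b (interiorTmul π T ξ)) =
      (θ.push hx hα).rep b (V (interiorTmul π T ξ))
    rw [Correspondence.induce_tmul]
    -- At `θ`, the left action of `b` on the module is by definition composition with `b` evaluated
    -- at `θ.push`, which is also the operator `(θ.push hx hα).rep b`; the two sides agree
    -- definitionally.
    refine (hV _).trans (Eq.trans ?_ (congrArg _ (hV _).symm))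
    rfl
  exact fun ξ => congr($this ξ)

/-- For a type I collection, the rank one operators of simple tensors lie in the image of the
restricted tensor product of the correspondences. -/
lemma exists_tensorCorrespondence_eq_rankOne (hx : CompatibleVectors p x)
    (hα : CompatibleCorrespondences p' x α) (hI : IsTypeICollection p' x α)
    (w z : RestrictedFamily X x) : ∃ a, tensorCorrespondence hx hα a =
      rankOne (CStarTensor A p) (moduleTmul hx w) (moduleTmul hx z) := by
  -- The second clause forces the choice `p' v` whenever it is available. By coherence this happens
  -- as soon as `w v = z v = x v`, hence for almost all `v`, so the choices form a simple tensor of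
  -- `⊗' (A'_v, p'_v)`.
  have h1 : ∀ v, ∃ a : A' v, α v a = rankOne (A v) (w v) (z v) ∧
      (α v (p' v) = rankOne (A v) (w v) (z v) → a = p' v) := by
    intro v
    by_cases hv : α v (p' v) = rankOne (A v) (w v) (z v)
    · exact ⟨p' v, hv, fun _ => rfl⟩
    · obtain ⟨a, ha⟩ := hI.2 v (rankOne (A v) (w v) (z v))
        (Submodule.le_topologicalClosure _ (Submodule.subset_span ⟨(w v, z v), rfl⟩))
      exact ⟨a, ha, fun h => absurd h hv⟩
  choose a ha ha' using h1
  let a' : CStarFamily A' p' := ⟨a, by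
    filter_upwards [hI.1, w.2, z.2] with v h1 h2 h3
    exact ha' v (by rw [h1, h2, h3])⟩
  -- Both operators are bounded, so comparing them on simple tensors is enough, and there everything
  -- is computed componentwise.
  refine ⟨cstarTmul a', ContinuousLinearMap.ext_on (s := Set.range (moduleTmul hx)) ?_ ?_⟩
  · exact Submodule.dense_iff_topologicalClosure_eq_top.2 (dense_span_moduleTmul hx)
  · rintro _ ⟨u, rfl⟩
    rw [tensorCorrespondence_tmul, rankOne_apply, inner_moduleTmul, act_moduleTmul]
    exact congrArg _ (Subtype.ext (funext fun v => congr($(ha v) (u v))))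

/-- A type I collection of correspondences carries type I representations to type I
representations. -/
lemma isTypeI_tensorCorrespondence_induce (hx : CompatibleVectors p x)
    (hα : CompatibleCorrespondences p' x α) (hI : IsTypeICollection p' x α)
    {π : CStarTensor A p →⋆ₙₐ[ℂ] (H →L[ℂ] H)} (hπ : IsTypeI π) :
    IsTypeI ((tensorCorrespondence hx hα).induce π) := by
  refine (tensorCorrespondence hx hα).isTypeI_induce (dense_span_moduleTmul hx)
    dense_span_cstarTmul ?_ hπ
  rintro _ ⟨w, rfl⟩ _ ⟨z, rfl⟩ _ ⟨a, rfl⟩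
  -- Simple tensors of the module are stable under the action of simple tensors of the algebra, so
  -- the operators required by `Correspondence.isTypeI_induce` are again rank one operators of
  -- simple tensors.
  rw [act_moduleTmul]
  exact exists_tensorCorrespondence_eq_rankOne hx hα hI (actFamily hx w a) z

end Induced

end AdelicTensor

theorem proposition5 {I : Type*} [Countable I] {A A' X : I → Type u}
    [∀ v, NonUnitalCStarAlgebra (A v)] [∀ v, NonUnitalCStarAlgebra (A' v)]
    [∀ v, NormedAddCommGroup (X v)] [∀ v, NormedSpace ℂ (X v)] [∀ v, CompleteSpace (X v)]
    [∀ v, AdelicTensor.RightHilbertModule (A v) (X v)]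
    (p : ∀ v, {q : A v // IsStarProjection q}) (hp : ∀ᶠ v in cofinite, (p v : A v) ≠ 0)
    (p' : ∀ v, {q : A' v // IsStarProjection q}) (hp' : ∀ᶠ v in cofinite, (p' v : A' v) ≠ 0)
    (x : ∀ v, X v) (hx : AdelicTensor.CompatibleVectors p x)
    (α : ∀ v, AdelicTensor.Correspondence (A' v) (A v) (X v))
    (hα : AdelicTensor.CompatibleCorrespondences p' x α)
    (hI : AdelicTensor.IsTypeICollection p' x α)
    {H : Type*} [NormedAddCommGroup H] [InnerProductSpace ℂ H] [CompleteSpace H]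
    (π : AdelicTensor.CStarTensor A p →⋆ₙₐ[ℂ] (H →L[ℂ] H))
    (θ : AdelicTensor.RepFamily A p) (hθ : AdelicTensor.UnitarilyEquivalent π θ.rep) :
    AdelicTensor.UnitarilyEquivalent
        ((AdelicTensor.tensorCorrespondence hx hα).induce π) (θ.push hx hα).rep ∧
      (AdelicTensor.IsTypeI π →
        AdelicTensor.IsTypeI ((AdelicTensor.tensorCorrespondence hx hα).induce π)) :=
  ⟨AdelicTensor.unitarilyEquivalent_induce hx hα hθ,
    AdelicTensor.isTypeI_tensorCorrespondence_induce hx hα hI⟩
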